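/- Let $d\ge 2$ and let $\theta$ be a real antisymmetric $d\times d$ matrix. Let $L_2(\mathbb T^d_\theta)$ be the Hilbert space with orthonormal basis $U^n=U_1^{n_1}\cdots U_d^{n_d}$ $(n\in\mathbb Z^d)$, where $U_1,\dots,U_d$ are unitary with $U_kU_l=e^{2\pi i\theta_{kl}}U_lU_k$; let $\lambda_l$ denote the action by left multiplication, let $L_\infty(\mathbb T^d_\theta)$ be the von Neumann algebra generated by the $\lambda_l(U^n)$, and let $C^\infty(\mathbb T^d_\theta)\subseteq L_\infty(\mathbb T^d_\theta)$ be the algebra of all $\sum_n c_nU^n$ for which $(n^\alpha c_n)_n$ is square-summable for every $\alpha\in\mathbb Z_{\ge0}^d$. Put $D_i(\sum_n c_nU^n)=\sum_n n_ic_nU^n$ and $\Delta=\sum_{i=1}^d D_i^2$. Let $P=\lambda_l(x)\Delta+\sum_{i=1}^d\lambda_l(a_i)D_i+\lambda_l(a)$, acting on $C^\infty(\mathbb T^d_\theta)$, with $x,a_i,a\in C^\infty(\mathbb T^d_\theta)$ and $x$ positive and invertible. For $s\in\mathbb R^d$ put $V(s)=\sum_{i=1}^d s_i\big(2\lambda_l(x)D_i+\lambda_l(a_i)\big)$.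 For $\mathscr A\subseteq\{1,\dots,m\}$ define $f_0^{\mathscr A}(s,z)=1$ and $f_m^{\mathscr A}(s,z)=W_m\big((x|s|^2+z)^{-1}f_{m-1}^{\mathscr A}(s,z)\big)$, where $W_m=V(s)$ if $m\in\mathscr A$ and $W_m=P$ otherwise, and $$\mathrm{corr}_k(s,z)=(x|s|^2+z)^{-1}\sum_{\frac k2\le m\le k}(-1)^m\sum_{\mathscr A\subseteq\{1,\dots,m\},\ |\mathscr A|=2m-k}f_m^{\mathscr A}(s,z).$$ The $k$-th local invariant of $P$ is $$I_k(P)=\int_{\mathbb R^d}\Big(\frac1{2\pi}\lim_{N\to\infty}\int_{-N}^{N}\mathrm{corr}_k(s,i\lambda)e^{i\lambda}\,d\lambda\Big)ds\in L_\infty(\mathbb T^d_\theta),$$ where the limit is taken in the weak operator topology and the integral over $\mathbb R^d$ is a weak integral in $L_\infty(\mathbb T^d_\theta)$; the coefficients $x,a_i,a$ are determined by $P$. **Proposition.** Let $x,y\in C^\infty(\mathbb T^d_\theta)$ be invertible with $x\ge 0$ and $[x,y]=0$. Then the operators $\lambda_l(x)\Delta$ and $\lambda_l(y^{-1}x)\Delta\lambda_l(y)$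 are of the above form, their second local invariants exist, and $$I_2\big(\lambda_l(y^{-1}x)\,\Delta\,\lambda_l(y)\big)=y^{-1}\cdot I_2\big(\lambda_l(x)\Delta\big)\cdot y .$$ -/

import Mathlib

open scoped BigOperators
open MeasureTheory Filter Topology

noncomputable section

namespace NCTorus

/-! ### The Hilbert space, the generators and the weak closure -/

/-- `L_2(𝕋^d_θ)`, written in its orthonormal basis `(U^n)`, `n ∈ ℤ^d`. -/
abbrev L2 (d : ℕ) : Type := lp (fun _ : Fin d → ℤ => ℂ) 2

/-- The phase in `U^n U^m = cocycle θ n m • U^(n+m)`, where `U^n = U_1^{n_1} ⋯ U_d^{n_d}` and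
`U_k U_l = e^{2 π i θ_{kl}} U_l U_k`: the factors `U_l^{m_l}` have to be moved to the left past
the factors `U_k^{n_k}` with `l < k`. -/
def cocycle {d : ℕ} (θ : Matrix (Fin d) (Fin d) ℝ) (n m : Fin d → ℤ) : ℂ :=
  Complex.exp (2 * Real.pi * Complex.I *
    ∑ k, ∑ l, if l < k then (θ k l : ℂ) * (n k : ℂ) * (m l : ℂ) else 0)

theorem norm_cocycle {d : ℕ} (θ : Matrix (Fin d) (Fin d) ℝ) (n m : Fin d → ℤ) :
    ‖cocycle θ n m‖ = 1 := by
  have h : (2 * Real.pi * Complex.I *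
      ∑ k, ∑ l, if l < k then (θ k l : ℂ) * (n k : ℂ) * (m l : ℂ) else 0 : ℂ) =
      ((2 * Real.pi * ∑ k, ∑ l, if l < k then θ k l * (n k : ℝ) * (m l : ℝ) else 0 : ℝ) : ℂ) *
        Complex.I := by
    push_cast
    simp only [apply_ite (Complex.ofReal), Complex.ofReal_zero, Complex.ofReal_mul,
      Complex.ofReal_intCast]
    ring
  rw [cocycle, h, Complex.norm_exp_ofReal_mul_I]

theorem cocycle_zero_right {d : ℕ} (θ : Matrix (Fin d) (Fin d) ℝ) (n : Fin d → ℤ) :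
    cocycle θ n 0 = 1 := by
  simp [cocycle]

theorem cocycle_zero_left {d : ℕ} (θ : Matrix (Fin d) (Fin d) ℝ) (n : Fin d → ℤ) :
    cocycle θ 0 n = 1 := by
  simp [cocycle]

theorem cocycle_add_left {d : ℕ} (θ : Matrix (Fin d) (Fin d) ℝ) (n n' m : Fin d → ℤ) :
    cocycle θ (n + n') m = cocycle θ n m * cocycle θ n' m := by
  rw [cocycle, cocycle, cocycle, ← Complex.exp_add, ← mul_add, ← Finset.sum_add_distrib]
  congr 2
  refine Finset.sum_congr rfl fun k _ => ?_
  rw [← Finset.sum_add_distrib]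
  refine Finset.sum_congr rfl fun l _ => ?_
  split_ifs
  · simp only [Pi.add_apply, Int.cast_add]
    ring
  · simp

theorem cocycle_add_right {d : ℕ} (θ : Matrix (Fin d) (Fin d) ℝ) (n m m' : Fin d → ℤ) :
    cocycle θ n (m + m') = cocycle θ n m * cocycle θ n m' := by
  rw [cocycle, cocycle, cocycle, ← Complex.exp_add, ← mul_add, ← Finset.sum_add_distrib]
  congr 2
  refine Finset.sum_congr rfl fun k _ => ?_
  rw [← Finset.sum_add_distrib]
  refine Finset.sum_congr rfl fun l _ => ?_
  split_ifs
  · simp only [Pi.add_apply, Int.cast_add]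
    ring
  · simp

/-- The coefficients of `U^n ξ`. -/
def shiftFun {d : ℕ} (θ : Matrix (Fin d) (Fin d) ℝ) (n : Fin d → ℤ) (ξ : (Fin d → ℤ) → ℂ) :
    (Fin d → ℤ) → ℂ :=
  fun p => cocycle θ n (p - n) * ξ (p - n)

theorem memℓp_shiftFun {d : ℕ} (θ : Matrix (Fin d) (Fin d) ℝ) (n : Fin d → ℤ) (ξ : L2 d) :
    Memℓp (shiftFun θ n ξ) 2 := by
  have h := lp.memℓp ξ
  rw [memℓp_gen_iff (by norm_num)] at h ⊢
  have h' := (Equiv.subRight n).summable_iff.mpr h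
  refine h'.congr fun p => ?_
  simp [shiftFun, norm_cocycle]

/-- `U^n` acting on `L_2(𝕋^d_θ)` by left multiplication. -/
def U {d : ℕ} (θ : Matrix (Fin d) (Fin d) ℝ) (n : Fin d → ℤ) : L2 d →L[ℂ] L2 d :=
  LinearMap.mkContinuous
    { toFun := fun ξ => (⟨shiftFun θ n ξ, memℓp_shiftFun θ n ξ⟩ : L2 d)
      map_add' := fun ξ η => by
        ext p
        exact mul_add _ _ _
      map_smul' := fun c ξ => by
        ext p
        exact mul_left_comm _ _ _ }
    1 (fun ξ => by
      rw [one_mul]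
      refine le_of_eq ?_
      rw [lp.norm_eq_tsum_rpow (by norm_num), lp.norm_eq_tsum_rpow (by norm_num)]
      congr 1
      rw [← (Equiv.subRight n).tsum_eq (fun p => ‖ξ p‖ ^ (2 : ENNReal).toReal)]
      refine tsum_congr fun p => ?_
      simp [shiftFun, norm_cocycle])

theorem U_apply {d : ℕ} (θ : Matrix (Fin d) (Fin d) ℝ) (n : Fin d → ℤ) (ξ : L2 d)
    (p : Fin d → ℤ) : U θ n ξ p = cocycle θ n (p - n) * ξ (p - n) := rfl

theorem norm_U_le {d : ℕ} (θ : Matrix (Fin d) (Fin d) ℝ) (n : Fin d → ℤ) : ‖U θ n‖ ≤ 1 :=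
  LinearMap.mkContinuous_norm_le _ zero_le_one _

theorem U_zero {d : ℕ} (θ : Matrix (Fin d) (Fin d) ℝ) : U θ 0 = 1 := by
  ext ξ p
  simp [U_apply, cocycle_zero_left]

theorem U_mul {d : ℕ} (θ : Matrix (Fin d) (Fin d) ℝ) (n m : Fin d → ℤ) :
    U θ n * U θ m = cocycle θ n m • U θ (n + m) := by
  ext ξ p
  have h : p - n = m + (p - (n + m)) := by abel
  have h2 : p - n - m = p - (n + m) := by abel
  simp only [mul_apply_eq_comp, U_apply, smul_apply,
    lp.coeFn_smul, Pi.smul_apply, smul_eq_mul, h2]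
  rw [h, cocycle_add_right, cocycle_add_left]
  ring

/-- The defining relations of the noncommutative torus. -/
theorem U_comm {d : ℕ} (θ : Matrix (Fin d) (Fin d) ℝ) (hθ : θ.transpose = -θ) (k l : Fin d) :
    U θ (Pi.single k 1) * U θ (Pi.single l 1) =
      Complex.exp (2 * Real.pi * Complex.I * θ k l) •
        (U θ (Pi.single l 1) * U θ (Pi.single k 1)) := by
  have h : ∀ k l : Fin d, cocycle θ (Pi.single k 1) (Pi.single l 1) =
      if l < k then Complex.exp (2 * Real.pi * Complex.I * θ k l) else 1 := by
    intro k l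
    rw [cocycle, Finset.sum_eq_single k, Finset.sum_eq_single l]
    · split_ifs <;> simp
    · intro j _ hj
      simp [Pi.single_eq_of_ne hj]
    · simp
    · intro j _ hj
      simp [Pi.single_eq_of_ne hj]
    · simp
  have hlk : θ l k = -θ k l := congrFun (congrFun hθ k) l
  rw [U_mul, U_mul, smul_smul, add_comm (Pi.single l 1 : Fin d → ℤ), h, h, hlk]
  congr 1
  rcases lt_trichotomy k l with hkl | hkl | hkl
  · simp [hkl, hkl.not_gt, ← Complex.exp_add]
  · subst hkl
    have h0 : θ k k = 0 := by linarith
    simp [h0]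
  · simp [hkl, hkl.not_gt]

/-- `L_∞(𝕋^d_θ)`: the von Neumann algebra generated by the unitaries `U^n`, as the double
commutant. -/
def Linfty {d : ℕ} (θ : Matrix (Fin d) (Fin d) ℝ) : Set (L2 d →L[ℂ] L2 d) :=
  Set.centralizer (Set.centralizer (Set.range (U θ)))

/-! ### Smooth elements -/

/-- `∑ a_n U^n ∈ L_2(𝕋^d_θ)` lies in the domain of all `D^α = D_1^{α_1} ⋯ D_d^{α_d}`, i.e. all
`(n^α a_n)_n` are square-summable. -/
def IsSmoothSeq {d : ℕ} (a : (Fin d → ℤ) → ℂ) : Prop :=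
  ∀ α : Fin d → ℕ, Memℓp (fun n => (∏ i, (n i : ℂ) ^ α i) * a n) 2

/-- A polynomial weight on `ℤ^d`. -/
def weight {d : ℕ} (k : ℕ) (n : Fin d → ℤ) : ℝ := ∏ i, (1 + |(n i : ℝ)|) ^ k

theorem one_le_weight {d : ℕ} (k : ℕ) (n : Fin d → ℤ) : 1 ≤ weight k n :=
  Finset.one_le_prod fun _ _ => one_le_pow₀ (le_add_of_nonneg_right (abs_nonneg _))

theorem weight_pos {d : ℕ} (k : ℕ) (n : Fin d → ℤ) : 0 < weight k n :=
  zero_lt_one.trans_le (one_le_weight k n)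

theorem weight_add_le {d : ℕ} (k : ℕ) (n m : Fin d → ℤ) :
    weight k (n + m) ≤ weight k n * weight k m := by
  rw [weight, weight, weight, ← Finset.prod_mul_distrib]
  refine Finset.prod_le_prod (fun i _ => by positivity) fun i _ => ?_
  rw [← mul_pow]
  refine pow_le_pow_left₀ (by positivity) ?_ k
  simp only [Pi.add_apply, Int.cast_add]
  nlinarith [abs_add_le (n i : ℝ) (m i : ℝ), abs_nonneg (n i : ℝ), abs_nonneg (m i : ℝ),
    mul_nonneg (abs_nonneg (n i : ℝ)) (abs_nonneg (m i : ℝ))]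

theorem weight_add_exp {d : ℕ} (k l : ℕ) (n : Fin d → ℤ) :
    weight (k + l) n = weight k n * weight l n := by
  simp [weight, pow_add, Finset.prod_mul_distrib]

theorem summable_weight_inv (d : ℕ) : Summable fun n : Fin d → ℤ => (weight 2 n)⁻¹ := by
  have h1 : Summable fun t : ℤ => ((1 + |(t : ℝ)|) ^ 2)⁻¹ := by
    have h := (Real.summable_one_div_int_pow (p := 2)).mpr (by norm_num)
    have h0 : Summable fun t : ℤ => 1 / (t : ℝ) ^ 2 + if t = 0 then (1 : ℝ) else 0 :=
      h.add (summable_of_hasFiniteSupport ((Set.finite_singleton (0 : ℤ)).subset (by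
        intro t ht
        by_contra hne
        simp_all)))
    refine h0.of_nonneg_of_le (fun t => by positivity) fun t => ?_
    by_cases ht : t = 0
    · simp [ht]
    · have hpos : 0 < (t : ℝ) ^ 2 := by positivity
      simp only [ht, if_false, add_zero, one_div]
      refine inv_anti₀ hpos ?_
      nlinarith [sq_abs (t : ℝ), abs_nonneg (t : ℝ)]
  induction d with
  | zero => exact Summable.of_finite
  | succ d ih =>
    have h2 := h1.mul_of_nonneg ih (fun _ => by positivity)
      (fun n => inv_nonneg.mpr (weight_pos 2 n).le)
    rw [← (Fin.consEquiv fun _ : Fin (d + 1) => ℤ).summable_iff]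
    refine h2.congr fun p => ?_
    simp [weight, Fin.prod_univ_succ, Fin.consEquiv, mul_comm]

theorem isSmoothSeq_iff {d : ℕ} (a : (Fin d → ℤ) → ℂ) :
    IsSmoothSeq a ↔ ∀ k : ℕ, Summable fun n => weight k n * ‖a n‖ := by
  constructor
  · intro h
    have hb : ∀ k : ℕ, ∃ C : ℝ, ∀ n, weight k n * ‖a n‖ ≤ C := by
      intro k
      have hα : ∀ S : Finset (Fin d), ∃ C : ℝ, ∀ n, (∏ i ∈ S, |(n i : ℝ)| ^ k) * ‖a n‖ ≤ C := by
        intro S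
        have hS := h (fun i => if i ∈ S then k else 0)
        refine ⟨‖(⟨_, hS⟩ : L2 d)‖, fun n => ?_⟩
        have := lp.norm_apply_le_norm (by norm_num) (⟨_, hS⟩ : L2 d) n
        refine le_trans (le_of_eq ?_) this
        simp [norm_prod, pow_ite, Finset.prod_ite_mem]
      choose C hC using hα
      refine ⟨∑ S : Finset (Fin d), (2 ^ k) ^ d * C S, fun n => ?_⟩
      have hw : weight k n ≤ ∑ S : Finset (Fin d), (2 ^ k) ^ d * ∏ i ∈ S, |(n i : ℝ)| ^ k := by
        have h1 : weight k n ≤ ∏ i, (2 ^ k * (1 + |(n i : ℝ)| ^ k)) := by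
          refine Finset.prod_le_prod (fun i _ => by positivity) fun i _ => ?_
          have h2 : (1 + |(n i : ℝ)|) ≤ 2 * max 1 |(n i : ℝ)| := by
            linarith [le_max_left 1 |(n i : ℝ)|, le_max_right 1 |(n i : ℝ)|]
          refine (pow_le_pow_left₀ (by positivity) h2 k).trans ?_
          rw [mul_pow]
          refine mul_le_mul_of_nonneg_left ?_ (by positivity)
          rcases max_choice 1 |(n i : ℝ)| with hm | hm <;> rw [hm]
          · rw [one_pow]
            linarith [pow_nonneg (abs_nonneg (n i : ℝ)) k]
          · linarith
        refine h1.trans (le_of_eq ?_)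
        rw [Finset.prod_mul_distrib, Finset.prod_one_add, ← Finset.mul_sum]
        simp
      calc weight k n * ‖a n‖
          ≤ (∑ S : Finset (Fin d), (2 ^ k) ^ d * ∏ i ∈ S, |(n i : ℝ)| ^ k) * ‖a n‖ :=
            mul_le_mul_of_nonneg_right hw (norm_nonneg _)
        _ = ∑ S : Finset (Fin d), (2 ^ k) ^ d * ((∏ i ∈ S, |(n i : ℝ)| ^ k) * ‖a n‖) := by
            rw [Finset.sum_mul]
            exact Finset.sum_congr rfl fun S _ => by ring
        _ ≤ _ := Finset.sum_le_sum fun S _ =>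
            mul_le_mul_of_nonneg_left (hC S n) (by positivity)
    intro k
    obtain ⟨C, hC⟩ := hb (k + 2)
    refine ((summable_weight_inv d).mul_left C).of_nonneg_of_le
      (fun n => mul_nonneg (weight_pos k n).le (norm_nonneg _)) fun n => ?_
    have := hC n
    rw [weight_add_exp] at this
    rw [← div_eq_mul_inv, le_div_iff₀ (weight_pos 2 n)]
    linarith
  · intro h α
    have h1 := h (∑ i, α i)
    have h2 : Summable fun n => ‖(∏ i, (n i : ℂ) ^ α i) * a n‖ := by
      refine h1.of_nonneg_of_le (fun n => norm_nonneg _) fun n => ?_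
      rw [norm_mul, norm_prod, weight]
      refine mul_le_mul_of_nonneg_right ?_ (norm_nonneg _)
      refine Finset.prod_le_prod (fun i _ => norm_nonneg _) fun i _ => ?_
      rw [norm_pow]
      have h3 : ‖(n i : ℂ)‖ ≤ 1 + |(n i : ℝ)| := by
        rw [Complex.norm_intCast]
        linarith
      refine (pow_le_pow_left₀ (norm_nonneg _) h3 _).trans ?_
      exact pow_le_pow_right₀ (by simp) (Finset.single_le_sum (fun _ _ => Nat.zero_le _)
        (Finset.mem_univ i))
    have h4 : Memℓp (fun n => (∏ i, (n i : ℂ) ^ α i) * a n) 1 := by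
      rw [memℓp_gen_iff (by norm_num)]
      simpa using h2
    exact h4.of_exponent_ge (by norm_num)

theorem IsSmoothSeq.summable_norm {d : ℕ} {a : (Fin d → ℤ) → ℂ} (ha : IsSmoothSeq a) :
    Summable fun n => ‖a n‖ := by
  refine ((isSmoothSeq_iff a).mp ha 0).congr fun n => ?_
  simp [weight]

theorem IsSmoothSeq.summable {d : ℕ} {a : (Fin d → ℤ) → ℂ} (ha : IsSmoothSeq a)
    (θ : Matrix (Fin d) (Fin d) ℝ) : Summable fun n => a n • U θ n := by
  refine Summable.of_norm_bounded ha.summable_norm fun n => ?_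
  rw [norm_smul]
  exact mul_le_of_le_one_right (norm_nonneg _) (norm_U_le θ n)

theorem IsSmoothSeq.add {d : ℕ} {a b : (Fin d → ℤ) → ℂ} (ha : IsSmoothSeq a)
    (hb : IsSmoothSeq b) : IsSmoothSeq (a + b) := by
  rw [isSmoothSeq_iff] at *
  intro k
  refine ((ha k).add (hb k)).of_nonneg_of_le
    (fun n => mul_nonneg (weight_pos k n).le (norm_nonneg _)) fun n => ?_
  rw [← mul_add]
  exact mul_le_mul_of_nonneg_left (norm_add_le _ _) (weight_pos k n).le

theorem isSmoothSeq_single {d : ℕ} (c : ℂ) :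
    IsSmoothSeq (Pi.single (0 : Fin d → ℤ) c) := by
  rw [isSmoothSeq_iff]
  intro k
  refine summable_of_hasFiniteSupport ((Set.finite_singleton (0 : Fin d → ℤ)).subset ?_)
  intro n hn
  by_contra hne
  exact hn (by simp [Pi.single_eq_of_ne hne])

theorem IsSmoothSeq.deriv {d : ℕ} {a : (Fin d → ℤ) → ℂ} (ha : IsSmoothSeq a) (i : Fin d) :
    IsSmoothSeq fun n => (n i : ℂ) * a n := by
  intro α
  have h := ha (α + Pi.single i 1)
  have e : (fun n : Fin d → ℤ => (∏ j, (n j : ℂ) ^ α j) * ((n i : ℂ) * a n)) =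
      fun n => (∏ j, (n j : ℂ) ^ (α + Pi.single i 1 : Fin d → ℕ) j) * a n := by
    funext n
    have : (∏ j, (n j : ℂ) ^ (Pi.single i 1 : Fin d → ℕ) j) = (n i : ℂ) := by
      rw [Finset.prod_eq_single i]
      · simp
      · intro j _ hj
        simp [Pi.single_eq_of_ne hj]
      · simp
    simp only [Pi.add_apply, pow_add, Finset.prod_mul_distrib, this]
    ring
  rw [e]
  exact h

/-- The coefficients of a product. -/
def twistedConv {d : ℕ} (θ : Matrix (Fin d) (Fin d) ℝ) (a b : (Fin d → ℤ) → ℂ) :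
    (Fin d → ℤ) → ℂ :=
  fun p => ∑' n, a n * b (p - n) * cocycle θ n (p - n)

/-- The change of variables `(p, n) ↦ (n, p - n)`. -/
def convEquiv (d : ℕ) : ((Fin d → ℤ) × (Fin d → ℤ)) ≃ ((Fin d → ℤ) × (Fin d → ℤ)) where
  toFun q := (q.2, q.1 - q.2)
  invFun q := (q.1 + q.2, q.1)
  left_inv q := by simp
  right_inv q := by simp

theorem isSmoothSeq_twistedConv {d : ℕ} (θ : Matrix (Fin d) (Fin d) ℝ) {a b : (Fin d → ℤ) → ℂ}
    (ha : IsSmoothSeq a) (hb : IsSmoothSeq b) : IsSmoothSeq (twistedConv θ a b) := by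
  have hs := ha.summable_norm.mul_of_nonneg hb.summable_norm (fun _ => norm_nonneg _)
    (fun _ => norm_nonneg _)
  have hs' := ((convEquiv d).summable_iff.mpr hs).prod_factor
  rw [isSmoothSeq_iff] at *
  intro k
  have h0 := (ha k).mul_of_nonneg (hb k)
    (fun n => mul_nonneg (weight_pos k n).le (norm_nonneg _))
    (fun n => mul_nonneg (weight_pos k n).le (norm_nonneg _))
  have h1 := (convEquiv d).summable_iff.mpr h0
  refine h1.prod.of_nonneg_of_le
    (fun n => mul_nonneg (weight_pos k n).le (norm_nonneg _)) fun p => ?_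
  have hp : Summable fun n => ‖a n * b (p - n) * cocycle θ n (p - n)‖ := by
    refine (hs' p).congr fun n => ?_
    simp [convEquiv, norm_cocycle]
  calc weight k p * ‖twistedConv θ a b p‖
      ≤ weight k p * ∑' n, ‖a n * b (p - n) * cocycle θ n (p - n)‖ :=
        mul_le_mul_of_nonneg_left (norm_tsum_le_tsum_norm hp) (weight_pos k p).le
    _ = ∑' n, weight k p * ‖a n * b (p - n) * cocycle θ n (p - n)‖ := tsum_mul_left.symm
    _ ≤ _ := by
      refine Summable.tsum_le_tsum (fun n => ?_) (hp.mul_left _) (h1.prod_factor p)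
      have hw := weight_add_le k n (p - n)
      rw [add_sub_cancel] at hw
      simp only [norm_mul, norm_cocycle, mul_one, Function.comp, convEquiv, Equiv.coe_fn_mk]
      calc weight k p * (‖a n‖ * ‖b (p - n)‖)
          ≤ (weight k n * weight k (p - n)) * (‖a n‖ * ‖b (p - n)‖) :=
            mul_le_mul_of_nonneg_right hw (by positivity)
        _ = _ := by ring

theorem hasSum_twistedConv {d : ℕ} (θ : Matrix (Fin d) (Fin d) ℝ) {a b : (Fin d → ℤ) → ℂ}
    (ha : IsSmoothSeq a) (hb : IsSmoothSeq b) :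
    HasSum (fun p => twistedConv θ a b p • U θ p)
      ((∑' n, a n • U θ n) * ∑' n, b n • U θ n) := by
  have hna : Summable fun n => ‖a n • U θ n‖ :=
    ha.summable_norm.of_nonneg_of_le (fun _ => norm_nonneg _) fun n => by
      rw [norm_smul]
      exact mul_le_of_le_one_right (norm_nonneg _) (norm_U_le θ n)
  have hnb : Summable fun n => ‖b n • U θ n‖ :=
    hb.summable_norm.of_nonneg_of_le (fun _ => norm_nonneg _) fun n => by
      rw [norm_smul]
      exact mul_le_of_le_one_right (norm_nonneg _) (norm_U_le θ n)
  have h := (summable_mul_of_summable_norm hna hnb).hasSum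
  rw [← tsum_mul_tsum_of_summable_norm hna hnb] at h
  have h' := (convEquiv d).hasSum_iff.mpr h
  have hs := ha.summable_norm.mul_of_nonneg hb.summable_norm (fun _ => norm_nonneg _)
    (fun _ => norm_nonneg _)
  have hs' := ((convEquiv d).summable_iff.mpr hs).prod_factor
  refine h'.prod_fiberwise fun p => ?_
  have hp : Summable fun n => a n * b (p - n) * cocycle θ n (p - n) := by
    refine Summable.of_norm ((hs' p).congr fun n => ?_)
    simp [convEquiv, norm_cocycle]
  have h2 := hp.hasSum.smul_const (U θ p)
  refine h2.congr_fun fun n => ?_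
  simp only [Function.comp, convEquiv, Equiv.coe_fn_mk, smul_mul_smul_comm, U_mul, smul_smul,
    add_sub_cancel]

/-- `C^∞(𝕋^d_θ)`, as a subalgebra of `L_∞(𝕋^d_θ)` in the representation `λ_l` on
`L_2(𝕋^d_θ)`. -/
def Smooth {d : ℕ} (θ : Matrix (Fin d) (Fin d) ℝ) : Subalgebra ℂ (L2 d →L[ℂ] L2 d) where
  carrier := {T | ∃ a, IsSmoothSeq a ∧ HasSum (fun n => a n • U θ n) T}
  mul_mem' := by
    rintro S T ⟨a, ha, hS⟩ ⟨b, hb, hT⟩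
    refine ⟨twistedConv θ a b, isSmoothSeq_twistedConv θ ha hb, ?_⟩
    rw [← hS.tsum_eq, ← hT.tsum_eq]
    exact hasSum_twistedConv θ ha hb
  add_mem' := by
    rintro S T ⟨a, ha, hS⟩ ⟨b, hb, hT⟩
    refine ⟨a + b, ha.add hb, ?_⟩
    simpa [add_smul] using hS.add hT
  algebraMap_mem' := by
    intro r
    refine ⟨Pi.single 0 r, isSmoothSeq_single r, ?_⟩
    have h := hasSum_single (f := fun n => (Pi.single (0 : Fin d → ℤ) r : _ → ℂ) n • U θ n) 0
      (fun n hn => by simp [Pi.single_eq_of_ne hn])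
    simpa [U_zero, Algebra.algebraMap_eq_smul_one] using h

/-- The coefficients of an element of `L_∞(𝕋^d_θ)`: those of `T 1 ∈ L_2(𝕋^d_θ)`. -/
def coeff {d : ℕ} (T : L2 d →L[ℂ] L2 d) (n : Fin d → ℤ) : ℂ :=
  T (lp.single 2 (0 : Fin d → ℤ) (1 : ℂ)) n

theorem coeff_U {d : ℕ} (θ : Matrix (Fin d) (Fin d) ℝ) (n m : Fin d → ℤ) :
    coeff (U θ n) m = Pi.single (M := fun _ => ℂ) n 1 m := by
  rw [coeff, U_apply]
  by_cases h : m = n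
  · subst h
    simp [cocycle_zero_right]
  · have h' : m - n ≠ 0 := sub_ne_zero.mpr h
    simp [Pi.single_eq_of_ne h, Pi.single_eq_of_ne h']

theorem coeff_eq {d : ℕ} {θ : Matrix (Fin d) (Fin d) ℝ} {a : (Fin d → ℤ) → ℂ}
    {T : L2 d →L[ℂ] L2 d} (hT : HasSum (fun n => a n • U θ n) T) : coeff T = a := by
  funext m
  have h1 := hT.mapL (ContinuousLinearMap.apply ℂ (L2 d) (lp.single 2 (0 : Fin d → ℤ) (1 : ℂ)))
  have h2 := h1.mapL (lp.evalCLM ℂ (fun _ : Fin d → ℤ => ℂ) 2 m)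
  have h3 := hasSum_single (f := fun n => a n * coeff (U θ n) m) m
    (fun n hn => by simp [coeff_U, Pi.single_eq_of_ne hn.symm])
  have h4 := h2.unique h3
  rw [coeff_U, Pi.single_eq_same, mul_one] at h4
  exact h4

theorem isSmoothSeq_coeff {d : ℕ} {θ : Matrix (Fin d) (Fin d) ℝ} (a : Smooth θ) :
    IsSmoothSeq (coeff (a : L2 d →L[ℂ] L2 d)) := by
  obtain ⟨c, hc, h⟩ := a.2
  rw [coeff_eq h]
  exact hc

/-- The derivation `D_i (∑ a_n U^n) = ∑ n_i a_n U^n` on `C^∞(𝕋^d_θ)`. -/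
def D {d : ℕ} (θ : Matrix (Fin d) (Fin d) ℝ) (i : Fin d) : Smooth θ →ₗ[ℂ] Smooth θ where
  toFun a := ⟨∑' n, ((n i : ℂ) * coeff (a : L2 d →L[ℂ] L2 d) n) • U θ n,
    _, (isSmoothSeq_coeff a).deriv i, (((isSmoothSeq_coeff a).deriv i).summable θ).hasSum⟩
  map_add' a b := by
    ext1
    simp only [Subalgebra.coe_add]
    rw [← Summable.tsum_add (((isSmoothSeq_coeff a).deriv i).summable θ)
      (((isSmoothSeq_coeff b).deriv i).summable θ)]
    refine tsum_congr fun n => ?_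
    rw [← add_smul]
    simp [coeff, mul_add]
  map_smul' c a := by
    ext1
    simp only [Subalgebra.coe_smul, RingHom.id_apply]
    rw [← Summable.tsum_const_smul c (((isSmoothSeq_coeff a).deriv i).summable θ)]
    refine tsum_congr fun n => ?_
    rw [smul_smul]
    simp [coeff, mul_left_comm]

/-- The Laplacian `Δ = ∑ D_i ^ 2`. -/
def Lap {d : ℕ} (θ : Matrix (Fin d) (Fin d) ℝ) : Smooth θ →ₗ[ℂ] Smooth θ :=
  ∑ i, D θ i ∘ₗ D θ i

/-- Left multiplication `λ_l(a)`, on the domain `C^∞(𝕋^d_θ)`. -/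
def lmul {d : ℕ} {θ : Matrix (Fin d) (Fin d) ℝ} (a : Smooth θ) : Smooth θ →ₗ[ℂ] Smooth θ :=
  LinearMap.mulLeft ℂ a

/-! ### The local invariants -/

/-- The coefficients of `P = λ_l(x) Δ + ∑ λ_l(a_i) D_i + λ_l(a)`. -/
structure Coeffs {d : ℕ} (θ : Matrix (Fin d) (Fin d) ℝ) where
  /-- The coefficient of the Laplacian. -/
  x : Smooth θ
  /-- The coefficients of the first order part. -/
  a₁ : Fin d → Smooth θ
  /-- The coefficient of order zero. -/
  a₀ : Smooth θ

/-- `P = λ_l(x) Δ + ∑ λ_l(a_i) D_i + λ_l(a)`. -/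
def Coeffs.op {d : ℕ} {θ : Matrix (Fin d) (Fin d) ℝ} (c : Coeffs θ) :
    Smooth θ →ₗ[ℂ] Smooth θ :=
  lmul c.x ∘ₗ Lap θ + ∑ i, lmul (c.a₁ i) ∘ₗ D θ i + lmul c.a₀

/-- `V(s) = ∑ s_i A_i`, where `A_i = 2 λ_l(x) D_i + λ_l(a_i)`. -/
def Coeffs.V {d : ℕ} {θ : Matrix (Fin d) (Fin d) ℝ} (c : Coeffs θ)
    (s : EuclideanSpace ℝ (Fin d)) : Smooth θ →ₗ[ℂ] Smooth θ :=
  ∑ i, (s i : ℂ) • ((2 : ℂ) • (lmul c.x ∘ₗ D θ i) + lmul (c.a₁ i))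

/-- `(x |s|² + z)⁻¹`, the inverse in `C^∞(𝕋^d_θ)`. -/
def Coeffs.res {d : ℕ} {θ : Matrix (Fin d) (Fin d) ℝ} (c : Coeffs θ)
    (s : EuclideanSpace ℝ (Fin d)) (z : ℂ) : Smooth θ :=
  Ring.inverse (((‖s‖ ^ 2 : ℝ) : ℂ) • c.x + z • (1 : Smooth θ))

open Classical in
/-- `f_0 = 1` and `f_m = W_m ((x |s|² + z)⁻¹ f_{m-1})`, where `W_m` is `V(s)` if `m ∈ A` and `P`
otherwise. -/
def Coeffs.f {d : ℕ} {θ : Matrix (Fin d) (Fin d) ℝ} (c : Coeffs θ) (A : Finset ℕ)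
    (s : EuclideanSpace ℝ (Fin d)) (z : ℂ) : ℕ → Smooth θ
  | 0 => 1
  | m + 1 => (if m + 1 ∈ A then c.V s else c.op) (c.res s z * c.f A s z m)

/-- `corr_k(s, z) = (x |s|² + z)⁻¹ ∑_{k/2 ≤ m ≤ k} (-1)^m ∑_A f_m^A(s, z)`, over the subsets `A`
of `{1, …, m}` with `2 m - k` elements. -/
def Coeffs.corr {d : ℕ} {θ : Matrix (Fin d) (Fin d) ℝ} (c : Coeffs θ) (k : ℕ)
    (s : EuclideanSpace ℝ (Fin d)) (z : ℂ) : Smooth θ :=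
  c.res s z * ∑ m ∈ (Finset.range (k + 1)).filter (fun m => k ≤ 2 * m),
    (-1 : ℂ) ^ m • ∑ A ∈ (Finset.Icc 1 m).powersetCard (2 * m - k), c.f A s z m

/-- `C = (2 π)⁻¹ lim_{N → ∞} ∫_{-N}^N corr_k(s, i λ) e^{i λ} dλ` in the weak operator topology. -/
def Coeffs.IsCorr {d : ℕ} {θ : Matrix (Fin d) (Fin d) ℝ} (c : Coeffs θ) (k : ℕ)
    (s : EuclideanSpace ℝ (Fin d)) (C : L2 d →L[ℂ] L2 d) : Prop :=
  ∀ ξ η : L2 d,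
    (∀ N : ℝ, IntervalIntegrable (fun t : ℝ => Complex.exp (t * Complex.I) *
      inner ℂ ξ ((c.corr k s (t * Complex.I) : L2 d →L[ℂ] L2 d) η)) volume (-N) N) ∧
    Tendsto (fun N : ℝ => (2 * Real.pi : ℂ)⁻¹ * ∫ t in (-N)..N, Complex.exp (t * Complex.I) *
      inner ℂ ξ ((c.corr k s (t * Complex.I) : L2 d →L[ℂ] L2 d) η)) atTop (𝓝 (inner ℂ ξ (C η)))

/-- `I = ∫_{ℝ^d} Corr_k(s) ds` as a weak integral in `L_∞(𝕋^d_θ)`. The normal functionals on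
`L_∞(𝕋^d_θ)` are the maps `T ↦ ⟪ξ, T η⟫`. The value at `s = 0`, where `x |s|² + z` can fail to be
invertible, does not matter. -/
def Coeffs.IsInvariant {d : ℕ} {θ : Matrix (Fin d) (Fin d) ℝ} (c : Coeffs θ) (k : ℕ)
    (I : L2 d →L[ℂ] L2 d) : Prop :=
  I ∈ Linfty θ ∧ ∃ C : EuclideanSpace ℝ (Fin d) → (L2 d →L[ℂ] L2 d),
    (∀ s, s ≠ 0 → C s ∈ Linfty θ ∧ c.IsCorr k s (C s)) ∧
    ∀ ξ η : L2 d, Integrable (fun s => inner ℂ ξ (C s η)) ∧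
      ∫ s, inner ℂ ξ (C s η) = inner ℂ ξ (I η)

/-- `I` is the `k`-th local invariant of the operator `P`, which has to be of the form
`λ_l(x) Δ + ∑ λ_l(a_i) D_i + λ_l(a)` with `x` positive and invertible. -/
def IsLocalInvariant {d : ℕ} {θ : Matrix (Fin d) (Fin d) ℝ} (k : ℕ)
    (P : Smooth θ →ₗ[ℂ] Smooth θ) (I : L2 d →L[ℂ] L2 d) : Prop :=
  ∃ c : Coeffs θ, (c.x : L2 d →L[ℂ] L2 d).IsPositive ∧ IsUnit c.x ∧ P = c.op ∧
    c.IsInvariant k I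

open Classical in
/-- The `k`-th local invariant `I_k(P)`, and `0` if it does not exist. -/
def localInvariant {d : ℕ} {θ : Matrix (Fin d) (Fin d) ℝ} (k : ℕ)
    (P : Smooth θ →ₗ[ℂ] Smooth θ) : L2 d →L[ℂ] L2 d :=
  if h : ∃ I, IsLocalInvariant k P I then h.choose else 0

end NCTorus

end

open scoped BigOperators
open MeasureTheory Filter Topology

noncomputable section

namespace NCTorus

variable {d : ℕ} {θ : Matrix (Fin d) (Fin d) ℝ}

/-! ### The algebra of smooth elements -/

theorem hasSum_coeff (a : Smooth θ) :
    HasSum (fun n => coeff (a : L2 d →L[ℂ] L2 d) n • U θ n) (a : L2 d →L[ℂ] L2 d) := by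
  obtain ⟨c, hc, h⟩ := a.2
  rw [coeff_eq h]
  exact h

theorem Smooth.ext_coeff {a b : Smooth θ}
    (h : coeff (a : L2 d →L[ℂ] L2 d) = coeff (b : L2 d →L[ℂ] L2 d)) : a = b := by
  apply Subtype.ext
  have ha := hasSum_coeff a
  rw [h] at ha
  exact ha.unique (hasSum_coeff b)

theorem coeff_D (i : Fin d) (a : Smooth θ) (n : Fin d → ℤ) :
    coeff (D θ i a : L2 d →L[ℂ] L2 d) n = n i * coeff (a : L2 d →L[ℂ] L2 d) n := by
  have h := (((isSmoothSeq_coeff a).deriv i).summable θ).hasSum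
  exact congrFun (coeff_eq h) n

theorem coeff_mul (a b : Smooth θ) :
    coeff ((a * b : Smooth θ) : L2 d →L[ℂ] L2 d) =
      twistedConv θ (coeff (a : L2 d →L[ℂ] L2 d)) (coeff (b : L2 d →L[ℂ] L2 d)) := by
  have h := hasSum_twistedConv θ (isSmoothSeq_coeff a) (isSmoothSeq_coeff b)
  rw [(hasSum_coeff a).tsum_eq, (hasSum_coeff b).tsum_eq] at h
  exact coeff_eq h

theorem coeff_add (S T : L2 d →L[ℂ] L2 d) (n : Fin d → ℤ) :
    coeff (S + T) n = coeff S n + coeff T n := rfl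

theorem IsSmoothSeq.summable_conv {a b : (Fin d → ℤ) → ℂ} (ha : IsSmoothSeq a)
    (hb : IsSmoothSeq b) (p : Fin d → ℤ) :
    Summable fun n => a n * b (p - n) * cocycle θ n (p - n) := by
  have hs := ha.summable_norm.mul_of_nonneg hb.summable_norm (fun _ => norm_nonneg _)
    (fun _ => norm_nonneg _)
  have hs' := ((convEquiv d).summable_iff.mpr hs).prod_factor
  refine Summable.of_norm ((hs' p).congr fun n => ?_)
  simp [convEquiv, norm_cocycle]

theorem D_mul (i : Fin d) (a b : Smooth θ) : D θ i (a * b) = D θ i a * b + a * D θ i b := by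
  apply Smooth.ext_coeff
  funext p
  rw [coeff_D, Subalgebra.coe_add, coeff_add, coeff_mul, coeff_mul, coeff_mul]
  have h1 := ((isSmoothSeq_coeff a).deriv i).summable_conv (θ := θ) (isSmoothSeq_coeff b) p
  have h2 := (isSmoothSeq_coeff a).summable_conv (θ := θ) ((isSmoothSeq_coeff b).deriv i) p
  have e1 : coeff (D θ i a : L2 d →L[ℂ] L2 d) = fun n => n i * coeff (a : L2 d →L[ℂ] L2 d) n :=
    funext (coeff_D i a)
  have e2 : coeff (D θ i b : L2 d →L[ℂ] L2 d) = fun n => n i * coeff (b : L2 d →L[ℂ] L2 d) n :=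
    funext (coeff_D i b)
  rw [e1, e2]
  unfold twistedConv
  rw [← h1.tsum_add h2, ← tsum_mul_left]
  refine tsum_congr fun n => ?_
  simp only [Pi.sub_apply, Int.cast_sub]
  ring

theorem D_comm (i j : Fin d) (a : Smooth θ) : D θ i (D θ j a) = D θ j (D θ i a) := by
  apply Smooth.ext_coeff
  funext n
  rw [coeff_D, coeff_D, coeff_D, coeff_D]
  ring

theorem D_one (i : Fin d) : D θ i 1 = 0 := by
  have h := D_mul (θ := θ) i 1 1
  rw [one_mul, one_mul, mul_one] at h
  exact left_eq_add.mp h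

theorem D_smul_one (i : Fin d) (c : ℂ) : D θ i (c • 1) = 0 := by
  rw [map_smul, D_one, smul_zero]

theorem Lap_apply (a : Smooth θ) : Lap θ a = ∑ i, D θ i (D θ i a) := by
  simp [Lap]

/-- The unitary `U^n` as a smooth element. -/
def smoothU (θ : Matrix (Fin d) (Fin d) ℝ) (n : Fin d → ℤ) : Smooth θ :=
  ⟨U θ n, Pi.single n 1, by
    rw [isSmoothSeq_iff]
    intro k
    refine summable_of_hasFiniteSupport ((Set.finite_singleton n).subset ?_)
    intro m hm
    by_contra hne
    exact hm (by simp [Pi.single_eq_of_ne hne]), by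
    have h := hasSum_single (f := fun m => (Pi.single n 1 : _ → ℂ) m • U θ m) n
      (fun m hm => by simp [Pi.single_eq_of_ne hm])
    simpa using h⟩

theorem D_smoothU (i : Fin d) (n : Fin d → ℤ) :
    D θ i (smoothU θ n) = (n i : ℂ) • smoothU θ n := by
  apply Smooth.ext_coeff
  funext m
  rw [coeff_D]
  change (m i : ℂ) * coeff (U θ n) m = (n i : ℂ) * coeff (U θ n) m
  rw [coeff_U]
  by_cases h : m = n
  · rw [h]
  · simp [Pi.single_eq_of_ne h]

theorem smoothU_mul_cancel (n : Fin d → ℤ) {a b : Smooth θ}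
    (h : a * smoothU θ n = b * smoothU θ n) : a = b := by
  have h1 : smoothU θ n * smoothU θ (-n) = cocycle θ n (-n) • 1 := by
    apply Subtype.ext
    change U θ n * U θ (-n) = cocycle θ n (-n) • 1
    rw [U_mul, add_neg_cancel, U_zero]
  have hc : cocycle θ n (-n) ≠ 0 := by
    intro h0
    have := norm_cocycle θ n (-n)
    rw [h0] at this
    simp at this
  have h2 := congrArg (· * smoothU θ (-n)) h
  simp only [mul_assoc, h1, mul_smul_comm, mul_one] at h2
  exact smul_right_injective _ hc h2

/-! ### The coefficients are determined by the operator -/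

theorem Coeffs.op_apply (c : Coeffs θ) (u : Smooth θ) :
    c.op u = c.x * Lap θ u + ∑ i, c.a₁ i * D θ i u + c.a₀ * u := by
  simp [Coeffs.op, lmul]

theorem Coeffs.V_apply (c : Coeffs θ) (s : EuclideanSpace ℝ (Fin d)) (u : Smooth θ) :
    c.V s u = ∑ i, (s i : ℂ) • ((2 : ℂ) • (c.x * D θ i u) + c.a₁ i * u) := by
  simp [Coeffs.V, lmul]

theorem Coeffs.op_smoothU (c : Coeffs θ) (n : Fin d → ℤ) :
    c.op (smoothU θ n) =
      ((∑ i, (n i : ℂ) * n i) • c.x + ∑ i, (n i : ℂ) • c.a₁ i + c.a₀) * smoothU θ n := by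
  simp [Coeffs.op_apply, Lap_apply, D_smoothU, Finset.mul_sum, Finset.sum_mul, Finset.sum_smul,
    add_mul, smul_smul]

theorem Coeffs.op_injective (hd : 0 < d) {c c' : Coeffs θ} (h : c.op = c'.op) : c = c' := by
  have key : ∀ n : Fin d → ℤ,
      (∑ i, (n i : ℂ) * n i) • c.x + ∑ i, (n i : ℂ) • c.a₁ i + c.a₀ =
        (∑ i, (n i : ℂ) * n i) • c'.x + ∑ i, (n i : ℂ) • c'.a₁ i + c'.a₀ := fun n =>
    smoothU_mul_cancel n (by rw [← c.op_smoothU, ← c'.op_smoothU, h])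
  have h0 : c.a₀ = c'.a₀ := by simpa using key 0
  have hs : ∀ (j : Fin d) (e : ℤ),
      ((e : ℂ) * e) • c.x + (e : ℂ) • c.a₁ j = ((e : ℂ) * e) • c'.x + (e : ℂ) • c'.a₁ j := by
    intro j e
    have hk := key (Pi.single j e)
    rw [h0] at hk
    have hq : (∑ i, ((Pi.single j e : Fin d → ℤ) i : ℂ) * (Pi.single j e : Fin d → ℤ) i) =
        (e : ℂ) * e := by
      rw [Finset.sum_eq_single j]
      · simp
      · intro i _ hi
        simp [Pi.single_eq_of_ne hi]
      · simp
    have hl : ∀ a : Fin d → Smooth θ,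
        ∑ i, ((Pi.single j e : Fin d → ℤ) i : ℂ) • a i = (e : ℂ) • a j := by
      intro a
      rw [Finset.sum_eq_single j]
      · simp
      · intro i _ hi
        simp [Pi.single_eq_of_ne hi]
      · simp
    rw [hq, hl, hl] at hk
    exact add_right_cancel hk
  have hx : c.x = c'.x := by
    have h1 := hs ⟨0, hd⟩ 1
    have h2 := hs ⟨0, hd⟩ (-1)
    simp only [Int.cast_one, Int.cast_neg, one_mul, one_smul, neg_mul_neg, neg_smul] at h1 h2
    have h3 : (2 : ℂ) • c.x = (2 : ℂ) • c'.x := by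
      rw [two_smul, two_smul]
      calc c.x + c.x = (c.x + c.a₁ ⟨0, hd⟩) + (c.x + -c.a₁ ⟨0, hd⟩) := by abel
        _ = _ := by rw [h1, h2]; abel
    exact smul_right_injective _ two_ne_zero h3
  have h1 : c.a₁ = c'.a₁ := by
    funext j
    have h1 := hs j 1
    simpa [hx] using h1
  cases c
  cases c'
  simp only at hx h1 h0
  rw [hx, h1, h0]

/-! ### Invertibility of smooth elements -/

/-- The element `∑ e^{i t n_j} a_n U^n`. -/
def rotate (θ : Matrix (Fin d) (Fin d) ℝ) (j : Fin d) (a : (Fin d → ℤ) → ℂ) (t : ℝ) :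
    L2 d →L[ℂ] L2 d :=
  ∑' n, (Complex.exp (t * n j * Complex.I) * a n) • U θ n

theorem norm_exp_mul_int_mul_I (t : ℝ) (m : ℤ) : ‖Complex.exp (t * m * Complex.I)‖ = 1 := by
  have := Complex.norm_exp_ofReal_mul_I (t * m)
  simpa using this

theorem isSmoothSeq_exp_mul {a : (Fin d → ℤ) → ℂ} (ha : IsSmoothSeq a) (j : Fin d) (t : ℝ) :
    IsSmoothSeq fun n => Complex.exp (t * n j * Complex.I) * a n := by
  rw [isSmoothSeq_iff] at ha ⊢
  intro k
  refine (ha k).congr fun n => ?_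
  rw [norm_mul, norm_exp_mul_int_mul_I, one_mul]

theorem isSmoothSeq_const_mul {a : (Fin d → ℤ) → ℂ} (ha : IsSmoothSeq a) (c : ℂ) :
    IsSmoothSeq fun n => c * a n := by
  rw [isSmoothSeq_iff] at ha ⊢
  intro k
  refine ((ha k).mul_left ‖c‖).congr fun n => ?_
  rw [norm_mul]
  ring

theorem hasDerivAt_rotate {a : (Fin d → ℤ) → ℂ} (ha : IsSmoothSeq a) (j : Fin d) (t : ℝ) :
    HasDerivAt (rotate θ j a) (rotate θ j (fun n => Complex.I * (n j * a n)) t) t := by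
  have h1 : ∀ (n : Fin d → ℤ) (t : ℝ),
      HasDerivAt (fun t : ℝ => (Complex.exp (t * n j * Complex.I) * a n) • U θ n)
        ((Complex.exp (t * n j * Complex.I) * (Complex.I * (n j * a n))) • U θ n) t := by
    intro n t
    have h0 : HasDerivAt (fun t : ℝ => (t : ℂ) * n j * Complex.I) (1 * n j * Complex.I) t :=
      ((Complex.ofRealCLM.hasDerivAt (x := t)).mul_const _).mul_const _
    have h1 := (h0.cexp.mul_const (a n)).smul_const (U θ n)
    rwa [show Complex.exp (t * n j * Complex.I) * (1 * n j * Complex.I) * a n =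
      Complex.exp (t * n j * Complex.I) * (Complex.I * (n j * a n)) by ring] at h1
  have h2 : ∀ (n : Fin d → ℤ) (t : ℝ),
      ‖(Complex.exp (t * n j * Complex.I) * (Complex.I * (n j * a n))) • U θ n‖ ≤
        ‖(n j : ℂ) * a n‖ := by
    intro n t
    rw [norm_smul, norm_mul, norm_exp_mul_int_mul_I, one_mul, norm_mul, Complex.norm_I, one_mul]
    exact mul_le_of_le_one_right (norm_nonneg _) (norm_U_le θ n)
  exact hasDerivAt_tsum (ha.deriv j).summable_norm h1 h2
    ((isSmoothSeq_exp_mul ha j 0).summable θ) t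

theorem contDiff_rotate {a : (Fin d → ℤ) → ℂ} (ha : IsSmoothSeq a) (j : Fin d) (k : ℕ) :
    ContDiff ℝ k (rotate θ j a) := by
  induction k generalizing a with
  | zero =>
    exact contDiff_zero.mpr (continuous_iff_continuousAt.mpr
      fun t => (hasDerivAt_rotate ha j t).continuousAt)
  | succ k ih =>
    have h := contDiff_succ_iff_deriv (𝕜 := ℝ) (n := k) (f := rotate θ j a)
    push_cast
    rw [h]
    refine ⟨fun t => (hasDerivAt_rotate ha j t).differentiableAt, by simp, ?_⟩
    rw [show deriv (rotate θ j a) = rotate θ j (fun n => Complex.I * (n j * a n)) from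
      funext fun t => (hasDerivAt_rotate ha j t).deriv]
    exact ih (isSmoothSeq_const_mul (ha.deriv j) _)


theorem memℓp_phase (j : Fin d) (t : ℝ) (ξ : L2 d) :
    Memℓp (fun n => Complex.exp (t * n j * Complex.I) * ξ n) 2 := by
  have h := lp.memℓp ξ
  rw [memℓp_gen_iff (by norm_num)] at h ⊢
  refine h.congr fun p => ?_
  rw [norm_mul, norm_exp_mul_int_mul_I, one_mul]

/-- The unitary `(ξ_n) ↦ (e^{i t n_j} ξ_n)` on `L_2`. -/
def phase (j : Fin d) (t : ℝ) (ξ : L2 d) : L2 d :=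
  ⟨_, memℓp_phase j t ξ⟩

theorem rotate_apply_phase {a : (Fin d → ℤ) → ℂ} (ha : IsSmoothSeq a) (j : Fin d) (t : ℝ)
    (ξ : L2 d) :
    rotate θ j a t (phase j t ξ) = phase j t ((∑' n, a n • U θ n) ξ) := by
  have hsum : ∀ (b : (Fin d → ℤ) → ℂ), IsSmoothSeq b → ∀ (η : L2 d) (p : Fin d → ℤ),
      HasSum (fun n => b n * (cocycle θ n (p - n) * η (p - n))) ((∑' n, b n • U θ n) η p) := by
    intro b hb η p
    have h1 := (hb.summable θ).hasSum.mapL (ContinuousLinearMap.apply ℂ (L2 d) η)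
    exact h1.mapL (lp.evalCLM ℂ (fun _ : Fin d → ℤ => ℂ) 2 p)
  ext p
  have h1 := hsum _ (isSmoothSeq_exp_mul ha j t) (phase j t ξ) p
  have h2 := (hsum a ha ξ p).mul_left (Complex.exp (t * p j * Complex.I))
  refine h1.unique (h2.congr_fun fun n => ?_)
  change _ * (_ * (Complex.exp (t * (p - n) j * Complex.I) * ξ (p - n))) = _
  have he : Complex.exp (t * p j * Complex.I) =
      Complex.exp (t * n j * Complex.I) * Complex.exp (t * (p - n) j * Complex.I) := by
    rw [← Complex.exp_add]
    congr 1
    simp only [Pi.sub_apply, Int.cast_sub]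
    ring
  rw [he]
  ring

theorem phase_neg (j : Fin d) (t : ℝ) (ξ : L2 d) : phase j t (phase j (-t) ξ) = ξ := by
  ext p
  change Complex.exp _ * (Complex.exp _ * ξ p) = ξ p
  rw [← mul_assoc, ← Complex.exp_add]
  push_cast
  rw [show (t : ℂ) * p j * Complex.I + -t * p j * Complex.I = 0 by ring, Complex.exp_zero, one_mul]

theorem phase_single (j : Fin d) (t : ℝ) :
    phase j t (lp.single 2 (0 : Fin d → ℤ) (1 : ℂ)) = lp.single 2 (0 : Fin d → ℤ) (1 : ℂ) := by
  ext p
  change Complex.exp _ * _ = _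
  by_cases hp : p = 0
  · simp [hp]
  · simp [Pi.single_eq_of_ne hp]

theorem isSmoothSeq_of_memℓp_pow {c : (Fin d → ℤ) → ℂ}
    (h0 : Memℓp c 2) (h : ∀ (j : Fin d) (k : ℕ), Memℓp (fun n => (n j : ℂ) ^ k * c n) 2) :
    IsSmoothSeq c := by
  intro α
  set K := ∑ i, α i with hK
  have h0' := h0
  have hj := fun j => h j K
  simp only [memℓp_gen_iff (p := 2) (by norm_num)] at h0' hj ⊢
  refine (h0'.add (summable_sum (s := Finset.univ) fun j _ => hj j)).of_nonneg_of_le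
    (fun n => by positivity) fun n => ?_
  have e : ∀ t : ℝ, t ^ (ENNReal.toReal 2) = t ^ 2 := fun t => by
    rw [ENNReal.toReal_ofNat]
    exact Real.rpow_natCast _ 2
  simp only [e, norm_mul, norm_prod, norm_pow, mul_pow _ ‖c n‖]
  rw [← Finset.sum_mul, ← one_add_mul]
  refine mul_le_mul_of_nonneg_right ?_ (by positivity)
  rcases isEmpty_or_nonempty (Fin d) with hE | hE
  · simp
  · obtain ⟨j, -, hmax⟩ := Finset.exists_max_image (Finset.univ : Finset (Fin d))
      (fun i => ‖(n i : ℂ)‖) Finset.univ_nonempty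
    calc (∏ i, ‖(n i : ℂ)‖ ^ α i) ^ 2 ≤ (∏ i, ‖(n j : ℂ)‖ ^ α i) ^ 2 := by
          refine pow_le_pow_left₀ (Finset.prod_nonneg fun i _ => by positivity) ?_ 2
          exact Finset.prod_le_prod (fun i _ => by positivity) fun i hi =>
            pow_le_pow_left₀ (norm_nonneg _) (hmax i hi) _
      _ = (‖(n j : ℂ)‖ ^ K) ^ 2 := by rw [Finset.prod_pow_eq_pow_sum]
      _ ≤ ∑ j, (‖(n j : ℂ)‖ ^ K) ^ 2 :=
          Finset.single_le_sum (f := fun j => (‖(n j : ℂ)‖ ^ K) ^ 2)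
            (fun i _ => by positivity) (Finset.mem_univ j)
      _ ≤ _ := by linarith

theorem isUnit_rotate {a : (Fin d → ℤ) → ℂ} (ha : IsSmoothSeq a)
    (hu : IsUnit (∑' n, a n • U θ n)) (j : Fin d) (t : ℝ) : IsUnit (rotate θ j a t) := by
  rw [ContinuousLinearMap.isUnit_iff_bijective] at hu ⊢
  constructor
  · intro ξ η hξη
    have h1 := rotate_apply_phase (θ := θ) ha j t (phase j (-t) ξ)
    have h2 := rotate_apply_phase (θ := θ) ha j t (phase j (-t) η)
    rw [phase_neg] at h1 h2
    rw [h1, h2] at hξη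
    have h3 := congrArg (phase j (-t)) hξη
    have hn : ∀ ζ : L2 d, phase j (-t) (phase j t ζ) = ζ := fun ζ => by
      simpa using phase_neg j (-t) ζ
    rw [hn, hn] at h3
    have h4 := congrArg (phase j t) (hu.1 h3)
    rwa [phase_neg, phase_neg] at h4
  · intro ζ
    obtain ⟨ξ, hξ⟩ := hu.2 (phase j (-t) ζ)
    exact ⟨phase j t ξ, by rw [rotate_apply_phase ha, hξ, phase_neg]⟩

/-- An element of `C^∞(𝕋^d_θ)` which is invertible as an operator is invertible in
`C^∞(𝕋^d_θ)`. -/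
theorem Smooth.isUnit_of_isUnit_coe {T : Smooth θ} (hT : IsUnit (T : L2 d →L[ℂ] L2 d)) :
    IsUnit T := by
  set e₀ : L2 d := lp.single 2 (0 : Fin d → ℤ) (1 : ℂ) with he₀
  set a := coeff (T : L2 d →L[ℂ] L2 d) with ha'
  have ha : IsSmoothSeq a := isSmoothSeq_coeff T
  have hTa : ∑' n, a n • U θ n = (T : L2 d →L[ℂ] L2 d) := (hasSum_coeff T).tsum_eq
  obtain ⟨c, hc⟩ := (ContinuousLinearMap.isUnit_iff_bijective.mp hT).2 e₀
  have hu : ∀ j t, IsUnit (rotate θ j a t) := isUnit_rotate ha (by rw [hTa]; exact hT)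
  have hg : ∀ (j : Fin d) (t : ℝ), Ring.inverse (rotate θ j a t) e₀ = phase j t c := by
    intro j t
    have h1 := rotate_apply_phase (θ := θ) ha j t c
    rw [hTa, hc, phase_single] at h1
    rw [he₀, ← h1]
    change (Ring.inverse (rotate θ j a t) * rotate θ j a t) (phase j t c) = _
    rw [Ring.inverse_mul_cancel _ (hu j t)]
    rfl
  have hsm : ∀ (j : Fin d) (k : ℕ), ContDiff ℝ k (fun t => phase j t c) := by
    intro j k
    have h1 : ContDiff ℝ k fun t => Ring.inverse (rotate θ j a t) := by
      refine contDiff_iff_contDiffAt.mpr fun t => ?_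
      obtain ⟨u, hu'⟩ := hu j t
      have h2 := contDiffAt_ringInverse (n := k) ℝ u
      rw [hu'] at h2
      exact h2.comp t (contDiff_rotate ha j k).contDiffAt
    have h3 := ((ContinuousLinearMap.apply ℂ (L2 d) e₀).restrictScalars ℝ).contDiff.comp h1
    exact (funext fun t => (hg j t).symm : (fun t => phase j t c) = _) ▸ h3
  have hder : ∀ (j : Fin d) (k : ℕ) (t : ℝ) (n : Fin d → ℤ),
      iteratedDeriv k (fun t => phase j t c) t n =
        Complex.exp (t * n j * Complex.I) * ((n j * Complex.I) ^ k * c n) := by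
    intro j k
    induction k with
    | zero =>
      intro t n
      rw [iteratedDeriv_zero, pow_zero, one_mul]
      rfl
    | succ k ih =>
      intro t n
      have h1 : HasDerivAt (iteratedDeriv k fun t => phase j t c)
          (iteratedDeriv (k + 1) (fun t => phase j t c) t) t := by
        rw [iteratedDeriv_succ]
        exact ((hsm j (k + 1)).differentiable_iteratedDeriv k
          (by exact_mod_cast Nat.lt_succ_self k) t).hasDerivAt
      have h2 := ((lp.evalCLM ℂ (fun _ : Fin d → ℤ => ℂ) 2 n).restrictScalars
        ℝ).hasFDerivAt.comp_hasDerivAt t h1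
      have h3 : HasDerivAt (fun t : ℝ => Complex.exp (t * n j * Complex.I) *
          ((n j * Complex.I) ^ k * c n)) (Complex.exp (t * n j * Complex.I) *
          ((n j * Complex.I) ^ (k + 1) * c n)) t := by
        have h0 : HasDerivAt (fun t : ℝ => (t : ℂ) * n j * Complex.I) (1 * n j * Complex.I) t :=
          ((Complex.ofRealCLM.hasDerivAt (x := t)).mul_const _).mul_const _
        have h4 := h0.cexp.mul_const ((n j * Complex.I) ^ k * c n)
        rwa [show Complex.exp (t * n j * Complex.I) * (1 * n j * Complex.I) *
          ((n j * Complex.I) ^ k * c n) = Complex.exp (t * n j * Complex.I) *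
          ((n j * Complex.I) ^ (k + 1) * c n) by ring] at h4
      exact (h2.congr_of_eventuallyEq (Eventually.of_forall fun t => (ih t n).symm)).unique h3
  have hcs : IsSmoothSeq c := by
    refine isSmoothSeq_of_memℓp_pow (lp.memℓp c) fun j k => ?_
    have h1 := lp.memℓp (iteratedDeriv k (fun t => phase j t c) 0)
    rw [memℓp_gen_iff (by norm_num)] at h1 ⊢
    refine h1.congr fun n => ?_
    rw [hder]
    simp [mul_pow]
  let S : Smooth θ := ⟨∑' n, c n • U θ n, c, hcs, (hcs.summable θ).hasSum⟩
  have hS : (S : L2 d →L[ℂ] L2 d) e₀ = c := by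
    ext n
    exact congrFun (coeff_eq (hcs.summable θ).hasSum) n
  have hTS : T * S = 1 := by
    apply Smooth.ext_coeff
    funext n
    change (T : L2 d →L[ℂ] L2 d) ((S : L2 d →L[ℂ] L2 d) e₀) n = e₀ n
    rw [hS, hc]
  have hST : S * T = 1 := by
    apply Subtype.ext
    have h1 : (T : L2 d →L[ℂ] L2 d) * (S : L2 d →L[ℂ] L2 d) = 1 := congrArg Subtype.val hTS
    refine hT.mul_left_cancel ?_
    rw [Subalgebra.coe_mul, ← mul_assoc, h1, one_mul, Subalgebra.coe_one, mul_one]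
  exact ⟨⟨T, S, hTS, hST⟩, rfl⟩

theorem Smooth.coe_inverse (T : Smooth θ) :
    ((Ring.inverse T : Smooth θ) : L2 d →L[ℂ] L2 d) = Ring.inverse (T : L2 d →L[ℂ] L2 d) := by
  by_cases h : IsUnit T
  · obtain ⟨u, rfl⟩ := h
    rw [Ring.inverse_unit]
    exact (Ring.inverse_unit (Units.map (Smooth θ).val.toMonoidHom u)).symm
  · rw [Ring.inverse_non_unit _ h,
      Ring.inverse_non_unit _ fun h' => h (Smooth.isUnit_of_isUnit_coe h')]
    rfl

/-! ### The resolvent -/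

instance : Nontrivial (L2 d) :=
  ⟨⟨lp.single 2 (0 : Fin d → ℤ) (1 : ℂ), 0, fun h => by
    have h1 := congrArg (fun ξ : L2 d => ξ 0) h
    simp at h1⟩⟩

theorem exists_lowerBound_of_isPositive {H : Type*} [NormedAddCommGroup H]
    [InnerProductSpace ℂ H] [CompleteSpace H] [Nontrivial H] {x : H →L[ℂ] H}
    (hpos : x.IsPositive) (hx : IsUnit x) :
    ∃ κ : ℝ, 0 < κ ∧ ∀ ξ : H, κ * ‖ξ‖ ^ 2 ≤ (inner ℂ (x ξ) ξ).re := by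
  have h0 : (0 : H →L[ℂ] H) ≤ x := (ContinuousLinearMap.nonneg_iff_isPositive x).mpr hpos
  have hsp : IsStrictlyPositive x := IsStrictlyPositive.iff_of_unital.mpr ⟨h0, hx⟩
  obtain ⟨κ, hκ, hle⟩ := (CFC.exists_pos_algebraMap_le_iff (A := H →L[ℂ] H)
    hsp.isSelfAdjoint).2 fun t ht => hsp.spectrum_pos ht
  refine ⟨κ, hκ, fun ξ => ?_⟩
  have h2 := (ContinuousLinearMap.le_def _ _).mp hle
  have h3 := h2.re_inner_nonneg_left ξ
  rw [Algebra.algebraMap_eq_smul_one] at h3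
  have h4 : (inner ℂ ((κ • (1 : H →L[ℂ] H)) ξ) ξ).re = κ * ‖ξ‖ ^ 2 := by
    change (inner ℂ (κ • ξ) ξ).re = _
    rw [inner_smul_left_eq_smul, Complex.real_smul, Complex.re_ofReal_mul]
    congr 1
    exact inner_self_eq_norm_sq (𝕜 := ℂ) ξ
  rw [sub_apply, inner_sub_left, map_sub] at h3
  simp only [RCLike.re_to_complex] at h3
  linarith

/-- `x` is positive and bounded below by `κ > 0`. -/
structure IsBoundedBelow (x : Smooth θ) (κ : ℝ) : Prop where
  pos : 0 < κ
  isPositive : (x : L2 d →L[ℂ] L2 d).IsPositive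
  le_inner : ∀ ξ : L2 d, κ * ‖ξ‖ ^ 2 ≤ (inner ℂ ((x : L2 d →L[ℂ] L2 d) ξ) ξ).re

theorem exists_isBoundedBelow {x : Smooth θ} (hpos : (x : L2 d →L[ℂ] L2 d).IsPositive)
    (hx : IsUnit x) : ∃ κ, IsBoundedBelow x κ := by
  obtain ⟨κ, hκ, h⟩ := exists_lowerBound_of_isPositive hpos (hx.map (Smooth θ).val)
  exact ⟨κ, hκ, hpos, h⟩

/-- `x |s|² + z`. -/
def pencil (x : Smooth θ) (s : EuclideanSpace ℝ (Fin d)) (z : ℂ) : Smooth θ :=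
  ((‖s‖ ^ 2 : ℝ) : ℂ) • x + z • (1 : Smooth θ)

/-- `(x |s|² + z)⁻¹`. -/
def resolvent (x : Smooth θ) (s : EuclideanSpace ℝ (Fin d)) (z : ℂ) : Smooth θ :=
  Ring.inverse (pencil x s z)

theorem coe_pencil (x : Smooth θ) (s : EuclideanSpace ℝ (Fin d)) (z : ℂ) :
    (pencil x s z : L2 d →L[ℂ] L2 d) =
      ((‖s‖ ^ 2 : ℝ) : ℂ) • (x : L2 d →L[ℂ] L2 d) + z • (1 : L2 d →L[ℂ] L2 d) := rfl

theorem continuous_coe_pencil (x : Smooth θ) :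
    Continuous fun p : EuclideanSpace ℝ (Fin d) × ℂ =>
      (pencil x p.1 p.2 : L2 d →L[ℂ] L2 d) := by
  simp only [coe_pencil]
  fun_prop

/-- The numerical range of `x |s|² + z` keeps this distance from zero. -/
def margin (κ : ℝ) (s : EuclideanSpace ℝ (Fin d)) (z : ℂ) : ℝ :=
  max (κ * ‖s‖ ^ 2 + z.re) |z.im|

theorem IsBoundedBelow.margin_mul_le {x : Smooth θ} {κ : ℝ} (h : IsBoundedBelow x κ)
    (s : EuclideanSpace ℝ (Fin d)) (z : ℂ) (ξ : L2 d) :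
    margin κ s z * ‖ξ‖ ^ 2 ≤ ‖inner ℂ ((pencil x s z : L2 d →L[ℂ] L2 d) ξ) ξ‖ := by
  have h1 : inner ℂ ((pencil x s z : L2 d →L[ℂ] L2 d) ξ) ξ =
      ((‖s‖ ^ 2 : ℝ) : ℂ) * inner ℂ ((x : L2 d →L[ℂ] L2 d) ξ) ξ +
        (starRingEnd ℂ) z * ((‖ξ‖ ^ 2 : ℝ) : ℂ) := by
    rw [coe_pencil]
    change inner ℂ (((‖s‖ ^ 2 : ℝ) : ℂ) • (x : L2 d →L[ℂ] L2 d) ξ + z • ξ) ξ = _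
    rw [inner_add_left, inner_smul_left, inner_smul_left, inner_self_eq_norm_sq_to_K,
      Complex.conj_ofReal]
    norm_cast
  have him : (inner ℂ ((x : L2 d →L[ℂ] L2 d) ξ) ξ).im = 0 := by
    have := h.isPositive.inner_nonneg_left ξ
    exact (Complex.nonneg_iff.mp this).2.symm
  have hsq : 0 ≤ ‖ξ‖ ^ 2 := by positivity
  rw [margin, max_mul_of_nonneg _ _ hsq, h1]
  refine max_le ?_ ?_
  · refine le_trans ?_ (Complex.re_le_norm _)
    rw [Complex.add_re, Complex.re_ofReal_mul, Complex.re_mul_ofReal, Complex.conj_re]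
    have := mul_le_mul_of_nonneg_left (h.le_inner ξ) (sq_nonneg ‖s‖)
    nlinarith
  · refine le_trans (le_of_eq ?_) (Complex.abs_im_le_norm _)
    rw [Complex.add_im, Complex.im_ofReal_mul, Complex.im_mul_ofReal, Complex.conj_im, him,
      mul_zero, zero_add, abs_mul, abs_neg, abs_of_nonneg hsq]

theorem IsBoundedBelow.isUnit_coe_pencil {x : Smooth θ} {κ : ℝ} (h : IsBoundedBelow x κ)
    {s : EuclideanSpace ℝ (Fin d)} {z : ℂ} (hz : 0 < κ * ‖s‖ ^ 2 + z.re) :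
    IsUnit (pencil x s z : L2 d →L[ℂ] L2 d) := by
  have hm : 0 < margin κ s z := hz.trans_le (le_max_left _ _)
  refine ContinuousLinearMap.isUnit_of_forall_le_norm_inner_map _ (c := ⟨margin κ s z, hm.le⟩)
    hm fun ξ => ?_
  rw [mul_comm]
  exact h.margin_mul_le s z ξ

theorem IsBoundedBelow.isUnit_pencil {x : Smooth θ} {κ : ℝ} (h : IsBoundedBelow x κ)
    {s : EuclideanSpace ℝ (Fin d)} {z : ℂ} (hz : 0 < κ * ‖s‖ ^ 2 + z.re) :
    IsUnit (pencil x s z) :=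
  Smooth.isUnit_of_isUnit_coe (h.isUnit_coe_pencil hz)

theorem IsBoundedBelow.norm_resolvent_le {x : Smooth θ} {κ : ℝ} (h : IsBoundedBelow x κ)
    {s : EuclideanSpace ℝ (Fin d)} {z : ℂ} (hz : 0 < κ * ‖s‖ ^ 2 + z.re) :
    ‖(resolvent x s z : L2 d →L[ℂ] L2 d)‖ ≤ (margin κ s z)⁻¹ := by
  have hm : 0 < margin κ s z := hz.trans_le (le_max_left _ _)
  refine ContinuousLinearMap.opNorm_le_bound _ (by positivity) fun ξ => ?_
  set η := (resolvent x s z : L2 d →L[ℂ] L2 d) ξ with hη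
  have h1 : (pencil x s z : L2 d →L[ℂ] L2 d) η = ξ := by
    have h2 : pencil x s z * resolvent x s z = 1 :=
      Ring.mul_inverse_cancel _ (h.isUnit_pencil hz)
    have h3 := congrArg (fun T : Smooth θ => (T : L2 d →L[ℂ] L2 d) ξ) h2
    exact h3
  have h2 := h.margin_mul_le s z η
  rw [h1] at h2
  have h3 := h2.trans (norm_inner_le_norm ξ η)
  rw [inv_mul_eq_div, le_div_iff₀ hm]
  rcases (norm_nonneg η).eq_or_lt with h0 | h0
  · rw [← h0, zero_mul]
    exact norm_nonneg _
  · refine le_of_mul_le_mul_right ?_ h0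
    nlinarith

theorem IsBoundedBelow.continuousAt_resolvent {x : Smooth θ} {κ : ℝ} (h : IsBoundedBelow x κ)
    {s : EuclideanSpace ℝ (Fin d)} {z : ℂ} (hz : 0 < κ * ‖s‖ ^ 2 + z.re) :
    ContinuousAt (fun p : EuclideanSpace ℝ (Fin d) × ℂ =>
      (resolvent x p.1 p.2 : L2 d →L[ℂ] L2 d)) (s, z) := by
  simp only [resolvent, Smooth.coe_inverse]
  obtain ⟨u, hu⟩ := h.isUnit_coe_pencil hz
  have h1 := NormedRing.inverse_continuousAt u
  have h2 : ContinuousAt (fun p : EuclideanSpace ℝ (Fin d) × ℂ =>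
      (pencil x p.1 p.2 : L2 d →L[ℂ] L2 d)) (s, z) := (continuous_coe_pencil x).continuousAt
  exact ContinuousAt.comp (f := fun p : EuclideanSpace ℝ (Fin d) × ℂ =>
      (pencil x p.1 p.2 : L2 d →L[ℂ] L2 d)) (g := Ring.inverse) (by rwa [← hu]) h2

theorem IsBoundedBelow.hasDerivAt_resolvent {x : Smooth θ} {κ : ℝ} (h : IsBoundedBelow x κ)
    {𝕜 : Type*} [RCLike 𝕜] [NormedAlgebra 𝕜 (L2 d →L[ℂ] L2 d)]
    {s : 𝕜 → EuclideanSpace ℝ (Fin d)} {z : 𝕜 → ℂ} {t : 𝕜} {T' : L2 d →L[ℂ] L2 d}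
    (hz : 0 < κ * ‖s t‖ ^ 2 + (z t).re)
    (hT : HasDerivAt (fun t => (pencil x (s t) (z t) : L2 d →L[ℂ] L2 d)) T' t) :
    HasDerivAt (fun t => (resolvent x (s t) (z t) : L2 d →L[ℂ] L2 d))
      (-((resolvent x (s t) (z t) : L2 d →L[ℂ] L2 d) * T' *
        (resolvent x (s t) (z t) : L2 d →L[ℂ] L2 d))) t := by
  simp only [resolvent, Smooth.coe_inverse]
  obtain ⟨u, hu⟩ := h.isUnit_coe_pencil hz
  have h1 := hasFDerivAt_ringInverse (𝕜 := 𝕜) u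
  rw [hu] at h1
  have h2 := h1.comp_hasDerivAt t hT
  rw [← hu, Ring.inverse_unit]
  exact h2

/-! ### Symbols -/

/-- Words with at least `k` factors `(x |s|² + z)⁻¹`, up to their values outside of the domain
`κ |s|² + Re z > 0`. -/
inductive IsSymbol (x : Smooth θ) (κ : ℝ) :
    ℕ → (EuclideanSpace ℝ (Fin d) → ℂ → Smooth θ) → Prop
  | const (a : Smooth θ) : IsSymbol x κ 0 fun _ _ => a
  | coord (i : Fin d) : IsSymbol x κ 0 fun s _ => (s i : ℂ) • (1 : Smooth θ)
  | res : IsSymbol x κ 1 fun s z => resolvent x s z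
  | add {k : ℕ} {F G : EuclideanSpace ℝ (Fin d) → ℂ → Smooth θ} :
      IsSymbol x κ k F → IsSymbol x κ k G → IsSymbol x κ k fun s z => F s z + G s z
  | mul {k l : ℕ} {F G : EuclideanSpace ℝ (Fin d) → ℂ → Smooth θ} :
      IsSymbol x κ k F → IsSymbol x κ l G → IsSymbol x κ (k + l) fun s z => F s z * G s z
  | mono {k : ℕ} {F : EuclideanSpace ℝ (Fin d) → ℂ → Smooth θ} :
      IsSymbol x κ (k + 1) F → IsSymbol x κ k F
  | congr {k : ℕ} {F G : EuclideanSpace ℝ (Fin d) → ℂ → Smooth θ} :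
      IsSymbol x κ k F → (∀ s z, 0 < κ * ‖s‖ ^ 2 + z.re → F s z = G s z) → IsSymbol x κ k G

namespace IsSymbol

variable {x : Smooth θ} {κ : ℝ} {k l : ℕ} {F G : EuclideanSpace ℝ (Fin d) → ℂ → Smooth θ}

theorem mono_le (hF : IsSymbol x κ l F) (hkl : k ≤ l) : IsSymbol x κ k F := by
  induction l, hkl using Nat.le_induction with
  | base => exact hF
  | succ l _ ih => exact ih hF.mono

theorem const_mul (hF : IsSymbol x κ k F) (a : Smooth θ) :
    IsSymbol x κ k fun s z => a * F s z := by
  have h := (IsSymbol.const (x := x) (κ := κ) a).mul hF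
  rwa [zero_add] at h

theorem mul_const (hF : IsSymbol x κ k F) (a : Smooth θ) :
    IsSymbol x κ k fun s z => F s z * a :=
  hF.mul (IsSymbol.const a)

theorem smul (hF : IsSymbol x κ k F) (c : ℂ) : IsSymbol x κ k fun s z => c • F s z :=
  (hF.const_mul (c • 1)).congr fun s z _ => by rw [smul_mul_assoc, one_mul]

theorem coord_smul (hF : IsSymbol x κ k F) (i : Fin d) :
    IsSymbol x κ k fun s z => (s i : ℂ) • F s z := by
  have h := (IsSymbol.coord (x := x) (κ := κ) i).mul hF
  rw [zero_add] at h
  exact h.congr fun s z _ => by rw [smul_mul_assoc, one_mul]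

theorem neg (hF : IsSymbol x κ k F) : IsSymbol x κ k fun s z => -F s z :=
  (hF.smul (-1)).congr fun s z _ => by rw [neg_smul, one_smul]

theorem sub (hF : IsSymbol x κ k F) (hG : IsSymbol x κ k G) :
    IsSymbol x κ k fun s z => F s z - G s z :=
  (hF.add hG.neg).congr fun s z _ => by rw [sub_eq_add_neg]

theorem zero (x : Smooth θ) (κ : ℝ) (k : ℕ) : IsSymbol x κ k fun _ _ => 0 := by
  induction k with
  | zero => exact IsSymbol.const 0
  | succ k ih => exact (ih.mul IsSymbol.res).congr fun s z _ => by rw [zero_mul]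

theorem sum {ι : Type*} (t : Finset ι)
    {F : ι → EuclideanSpace ℝ (Fin d) → ℂ → Smooth θ} (hF : ∀ i ∈ t, IsSymbol x κ k (F i)) :
    IsSymbol x κ k fun s z => ∑ i ∈ t, F i s z := by
  classical
  induction t using Finset.induction_on with
  | empty => simpa using IsSymbol.zero x κ k
  | insert i t hi ih =>
    simp only [Finset.sum_insert hi]
    exact (hF i (Finset.mem_insert_self i t)).add
      (ih fun j hj => hF j (Finset.mem_insert_of_mem hj))

theorem norm_sq_smul (hF : IsSymbol x κ k F) :
    IsSymbol x κ k fun s z => ((‖s‖ ^ 2 : ℝ) : ℂ) • F s z := by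
  refine (IsSymbol.sum Finset.univ fun i _ => (hF.coord_smul i).coord_smul i).congr
    fun s z _ => ?_
  simp only [smul_smul]
  rw [← Finset.sum_smul, EuclideanSpace.norm_sq_eq]
  congr 1
  push_cast
  refine Finset.sum_congr rfl fun i _ => ?_
  rw [Real.norm_eq_abs, ← Complex.ofReal_pow, sq_abs]
  push_cast
  ring

end IsSymbol

theorem D_pencil (x : Smooth θ) (s : EuclideanSpace ℝ (Fin d)) (z : ℂ) (i : Fin d) :
    D θ i (pencil x s z) = ((‖s‖ ^ 2 : ℝ) : ℂ) • D θ i x := by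
  rw [pencil, map_add, map_smul, D_smul_one, add_zero]

theorem IsBoundedBelow.D_resolvent {x : Smooth θ} {κ : ℝ} (h : IsBoundedBelow x κ)
    {s : EuclideanSpace ℝ (Fin d)} {z : ℂ} (hz : 0 < κ * ‖s‖ ^ 2 + z.re) (i : Fin d) :
    D θ i (resolvent x s z) =
      -(((‖s‖ ^ 2 : ℝ) : ℂ) • (resolvent x s z * D θ i x * resolvent x s z)) := by
  have h1 : pencil x s z * resolvent x s z = 1 := Ring.mul_inverse_cancel _ (h.isUnit_pencil hz)
  have h2 : resolvent x s z * pencil x s z = 1 := Ring.inverse_mul_cancel _ (h.isUnit_pencil hz)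
  have h3 := congrArg (D θ i) h1
  rw [D_mul, D_one, D_pencil] at h3
  have h4 := congrArg (resolvent x s z * ·) h3
  simp only [mul_add, mul_zero] at h4
  rw [← mul_assoc _ (pencil x s z), h2, one_mul] at h4
  rw [eq_neg_of_add_eq_zero_right h4, smul_mul_assoc, mul_smul_comm, mul_assoc]

namespace IsSymbol

variable {x : Smooth θ} {κ : ℝ} {k l : ℕ} {F G : EuclideanSpace ℝ (Fin d) → ℂ → Smooth θ}

protected theorem D (h : IsBoundedBelow x κ) (hF : IsSymbol x κ k F) (i : Fin d) :
    IsSymbol x κ k fun s z => D θ i (F s z) := by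
  induction hF with
  | const a => exact IsSymbol.const _
  | coord j => exact (IsSymbol.zero x κ 0).congr fun _ _ _ => (D_smul_one i _).symm
  | res =>
    refine IsSymbol.congr ?_ fun s z hz => (h.D_resolvent hz i).symm
    exact ((IsSymbol.res.mul_const _).mul IsSymbol.res).norm_sq_smul.neg.mono
  | add _ _ ihF ihG => exact (ihF.add ihG).congr fun _ _ _ => (map_add _ _ _).symm
  | mul hF hG ihF ihG =>
    exact ((ihF.mul hG).add (hF.mul ihG)).congr fun _ _ _ => (D_mul i _ _).symm
  | mono _ ih => exact ih.mono
  | congr _ he ih => exact ih.congr fun s z hz => congrArg _ (he s z hz)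

protected theorem Lap (h : IsBoundedBelow x κ) (hF : IsSymbol x κ k F) :
    IsSymbol x κ k fun s z => Lap θ (F s z) :=
  (IsSymbol.sum Finset.univ fun i _ => (hF.D h i).D h i).congr
    fun _ _ _ => (Lap_apply _).symm

protected theorem op {c : Coeffs θ} (h : IsBoundedBelow c.x κ) (hF : IsSymbol c.x κ k F) :
    IsSymbol c.x κ k fun s z => c.op (F s z) := by
  have h1 := ((hF.Lap h).const_mul c.x).add
    (IsSymbol.sum Finset.univ fun i _ => (hF.D h i).const_mul (c.a₁ i))
  exact (h1.add (hF.const_mul c.a₀)).congr fun _ _ _ => (c.op_apply _).symm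

protected theorem V {c : Coeffs θ} (h : IsBoundedBelow c.x κ) (hF : IsSymbol c.x κ k F) :
    IsSymbol c.x κ k fun s z => c.V s (F s z) :=
  (IsSymbol.sum Finset.univ fun i _ => ((((hF.D h i).const_mul c.x).smul 2).add
    (hF.const_mul (c.a₁ i))).coord_smul i).congr fun s _ _ => (c.V_apply s _).symm

protected theorem f {c : Coeffs θ} (h : IsBoundedBelow c.x κ) (A : Finset ℕ) (m : ℕ) :
    IsSymbol c.x κ m fun s z => c.f A s z m := by
  classical
  induction m with
  | zero => exact IsSymbol.const 1
  | succ m ih =>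
    have h1 : IsSymbol c.x κ (m + 1) fun s z => c.res s z * c.f A s z m := by
      rw [add_comm]
      exact (IsSymbol.res (x := c.x) (κ := κ)).mul ih
    by_cases hm : m + 1 ∈ A
    · exact (h1.V h).congr fun s z _ => by rw [Coeffs.f, if_pos hm]
    · exact (h1.op h).congr fun s z _ => by rw [Coeffs.f, if_neg hm]

protected theorem corr {c : Coeffs θ} (h : IsBoundedBelow c.x κ) {k : ℕ} (hk : 1 ≤ k) :
    IsSymbol c.x κ 2 fun s z => c.corr k s z := by
  have h1 : IsSymbol c.x κ 1 fun s z =>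
      ∑ m ∈ (Finset.range (k + 1)).filter (fun m => k ≤ 2 * m),
        (-1 : ℂ) ^ m • ∑ A ∈ (Finset.Icc 1 m).powersetCard (2 * m - k), c.f A s z m := by
    refine IsSymbol.sum _ fun m hm => IsSymbol.smul (IsSymbol.sum _ fun A _ => ?_) _
    rw [Finset.mem_filter] at hm
    exact (IsSymbol.f h A m).mono_le (by omega)
  exact (IsSymbol.res (x := c.x) (κ := κ)).mul h1

theorem isOpen_domain (κ : ℝ) :
    IsOpen {p : EuclideanSpace ℝ (Fin d) × ℂ | 0 < κ * ‖p.1‖ ^ 2 + p.2.re} := by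
  refine isOpen_lt continuous_const ?_
  have : Continuous fun p : EuclideanSpace ℝ (Fin d) × ℂ => p.2.re :=
    Complex.continuous_re.comp continuous_snd
  fun_prop

theorem continuousAt (h : IsBoundedBelow x κ) (hF : IsSymbol x κ k F)
    {s : EuclideanSpace ℝ (Fin d)} {z : ℂ} (hz : 0 < κ * ‖s‖ ^ 2 + z.re) :
    ContinuousAt (fun p : EuclideanSpace ℝ (Fin d) × ℂ => (F p.1 p.2 : L2 d →L[ℂ] L2 d))
      (s, z) := by
  induction hF with
  | const a => exact continuousAt_const
  | coord j =>
    have : Continuous fun p : EuclideanSpace ℝ (Fin d) × ℂ =>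
        (p.1 j : ℂ) • (1 : L2 d →L[ℂ] L2 d) := by fun_prop
    exact this.continuousAt
  | res => exact h.continuousAt_resolvent hz
  | add _ _ ihF ihG => exact ihF.add ihG
  | mul _ _ ihF ihG => exact ihF.mul ihG
  | mono _ ih => exact ih
  | congr _ he ih =>
    refine ih.congr_of_eventuallyEq ?_
    filter_upwards [(isOpen_domain κ).mem_nhds (show (s, z) ∈ _ from hz)] with p hp
    rw [he p.1 p.2 hp]

theorem differentiableAt (h : IsBoundedBelow x κ) (hF : IsSymbol x κ k F)
    {s : EuclideanSpace ℝ (Fin d)} {z : ℂ} (hz : 0 < κ * ‖s‖ ^ 2 + z.re) :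
    DifferentiableAt ℂ (fun z => (F s z : L2 d →L[ℂ] L2 d)) z := by
  induction hF with
  | const a => exact differentiableAt_const _
  | coord j => exact differentiableAt_const _
  | res =>
    have h1 : HasDerivAt (fun z => (pencil x s z : L2 d →L[ℂ] L2 d))
        ((1 : ℂ) • (1 : L2 d →L[ℂ] L2 d)) z := by
      simp only [coe_pencil]
      exact ((hasDerivAt_id z).smul_const _).const_add _
    exact (h.hasDerivAt_resolvent (s := fun _ : ℂ => s) (z := fun z => z) hz h1).differentiableAt
  | add _ _ ihF ihG => exact ihF.add ihG
  | mul _ _ ihF ihG => exact ihF.mul ihG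
  | mono _ ih => exact ih
  | congr _ he ih =>
    refine ih.congr_of_eventuallyEq ?_
    have hc : Continuous fun z : ℂ => (s, z) := by fun_prop
    filter_upwards [((isOpen_domain κ).preimage hc).mem_nhds hz] with w hw
    rw [he s w hw]

theorem exists_bound (h : IsBoundedBelow x κ) (hF : IsSymbol x κ k F) {δ : ℝ} (hδ : 0 < δ) :
    ∃ C : ℝ, 0 ≤ C ∧ ∃ K : ℕ, ∀ s z, δ ≤ κ * ‖s‖ ^ 2 + z.re →
      ‖(F s z : L2 d →L[ℂ] L2 d)‖ ≤ C * (1 + ‖s‖) ^ K * ((1 + |z.im|) ^ k)⁻¹ := by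
  induction hF with
  | const a => exact ⟨‖(a : L2 d →L[ℂ] L2 d)‖, norm_nonneg _, 0, fun s z _ => by simp⟩
  | coord j =>
    refine ⟨1, zero_le_one, 1, fun s z _ => ?_⟩
    change ‖(s j : ℂ) • (1 : L2 d →L[ℂ] L2 d)‖ ≤ _
    rw [norm_smul, norm_one, mul_one, Complex.norm_real]
    have := PiLp.norm_apply_le s j
    simp only [one_mul, pow_one, pow_zero, inv_one, mul_one]
    linarith
  | res =>
    refine ⟨1 + 1 / δ, by positivity, 0, fun s z hz => ?_⟩
    refine (h.norm_resolvent_le (hδ.trans_le hz)).trans ?_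
    have h1 : δ ≤ margin κ s z := hz.trans (le_max_left _ _)
    have h2 : |z.im| ≤ margin κ s z := le_max_right _ _
    rw [pow_zero, mul_one, pow_one, ← div_eq_mul_inv, le_div_iff₀ (by positivity),
      inv_mul_eq_div, div_le_iff₀ (hδ.trans_le h1), add_mul, one_mul, one_div, inv_mul_eq_div]
    have : 1 ≤ margin κ s z / δ := (one_le_div hδ).mpr h1
    linarith
  | add _ _ ihF ihG =>
    obtain ⟨C, hC, K, hF⟩ := ihF
    obtain ⟨C', hC', K', hG⟩ := ihG
    refine ⟨C + C', by positivity, max K K', fun s z hz => ?_⟩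
    refine (norm_add_le _ _).trans ((add_le_add (hF s z hz) (hG s z hz)).trans ?_)
    rw [← add_mul, add_mul C]
    have h1 : (1 : ℝ) ≤ 1 + ‖s‖ := by simp
    gcongr
    · exact le_max_left _ _
    · exact le_max_right _ _
  | mul _ _ ihF ihG =>
    obtain ⟨C, hC, K, hF⟩ := ihF
    obtain ⟨C', hC', K', hG⟩ := ihG
    refine ⟨C * C', by positivity, K + K', fun s z hz => ?_⟩
    refine (norm_mul_le _ _).trans ((mul_le_mul (hF s z hz) (hG s z hz) (norm_nonneg _)
      (by positivity)).trans (le_of_eq ?_))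
    rw [pow_add, pow_add, mul_inv]
    ring
  | mono _ ih =>
    obtain ⟨C, hC, K, hF⟩ := ih
    refine ⟨C, hC, K, fun s z hz => (hF s z hz).trans ?_⟩
    have h1 : (1 : ℝ) ≤ 1 + |z.im| := by simp
    gcongr
    omega
  | congr _ he ih =>
    obtain ⟨C, hC, K, hF⟩ := ih
    exact ⟨C, hC, K, fun s z hz => by
      rw [← he s z (hδ.trans_le hz)]
      exact hF s z hz⟩

end IsSymbol

/-! ### The von Neumann algebra -/

theorem Smooth.mem_Linfty (a : Smooth θ) : (a : L2 d →L[ℂ] L2 d) ∈ Linfty θ := by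
  intro m hm
  have h := hasSum_coeff a
  refine (h.mul_left m).unique ((h.mul_right m).congr_fun fun n => ?_)
  rw [mul_smul_comm, smul_mul_assoc, hm (U θ n) ⟨n, rfl⟩]

theorem const_mul_integral {X : Type*} [MeasurableSpace X] {μ : Measure X}
    {f : X → (L2 d →L[ℂ] L2 d)} (hf : Integrable f μ) (m : L2 d →L[ℂ] L2 d) :
    ∫ a, m * f a ∂μ = m * ∫ a, f a ∂μ :=
  (ContinuousLinearMap.mul ℂ (L2 d →L[ℂ] L2 d) m).integral_comp_comm hf

theorem integral_mul_const' {X : Type*} [MeasurableSpace X] {μ : Measure X}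
    {f : X → (L2 d →L[ℂ] L2 d)} (hf : Integrable f μ) (m : L2 d →L[ℂ] L2 d) :
    ∫ a, f a * m ∂μ = (∫ a, f a ∂μ) * m :=
  ((ContinuousLinearMap.mul ℂ (L2 d →L[ℂ] L2 d)).flip m).integral_comp_comm hf

theorem integral_mem_Linfty {X : Type*} [MeasurableSpace X] {μ : Measure X}
    {f : X → (L2 d →L[ℂ] L2 d)} (hf : Integrable f μ) (h : ∀ a, f a ∈ Linfty θ) :
    ∫ a, f a ∂μ ∈ Linfty θ := by
  intro m hm
  rw [← const_mul_integral hf, ← integral_mul_const' hf]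
  exact integral_congr_ae (Eventually.of_forall fun a => h a m hm)

theorem smul_mem_Linfty (c : ℂ) {T : L2 d →L[ℂ] L2 d} (h : T ∈ Linfty θ) : c • T ∈ Linfty θ := by
  intro m hm
  rw [mul_smul_comm, smul_mul_assoc, h m hm]

/-- The functional `T ↦ ⟪ξ, T η⟫`. -/
def matrixCoeff (ξ η : L2 d) : (L2 d →L[ℂ] L2 d) →L[ℂ] ℂ :=
  (innerSL ℂ ξ).comp (ContinuousLinearMap.apply ℂ (L2 d) η)

theorem matrixCoeff_apply (ξ η : L2 d) (T : L2 d →L[ℂ] L2 d) :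
    matrixCoeff ξ η T = inner ℂ ξ (T η) := rfl

/-! ### The inverse Laplace transform of a symbol -/

/-- The integrand `e^z F(s, z)` at `z = σ + i t`. -/
def laplaceIntegrand (F : EuclideanSpace ℝ (Fin d) → ℂ → Smooth θ)
    (s : EuclideanSpace ℝ (Fin d)) (z : ℂ) : L2 d →L[ℂ] L2 d :=
  Complex.exp z • (F s z : L2 d →L[ℂ] L2 d)

/-- `(2 π i)⁻¹ ∫_{Re z = 1} e^z F(s, z) dz`. -/
def laplaceInverse (F : EuclideanSpace ℝ (Fin d) → ℂ → Smooth θ)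
    (s : EuclideanSpace ℝ (Fin d)) : L2 d →L[ℂ] L2 d :=
  (2 * Real.pi : ℂ)⁻¹ • ∫ t : ℝ, laplaceIntegrand F s ((1 : ℝ) + t * Complex.I)

namespace IsSymbol

variable {x : Smooth θ} {κ : ℝ} {F G : EuclideanSpace ℝ (Fin d) → ℂ → Smooth θ}

theorem continuousAt_laplaceIntegrand {k : ℕ} (h : IsBoundedBelow x κ) (hF : IsSymbol x κ k F)
    {s : EuclideanSpace ℝ (Fin d)} {z : ℂ} (hz : 0 < κ * ‖s‖ ^ 2 + z.re) :
    ContinuousAt (fun p : EuclideanSpace ℝ (Fin d) × ℂ => laplaceIntegrand F p.1 p.2) (s, z) := by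
  have h1 : ContinuousAt (fun p : EuclideanSpace ℝ (Fin d) × ℂ => Complex.exp p.2) (s, z) := by
    fun_prop
  exact h1.smul (hF.continuousAt h hz)

theorem exists_bound_laplaceIntegrand (h : IsBoundedBelow x κ) (hF : IsSymbol x κ 2 F) {δ : ℝ}
    (hδ : 0 < δ) : ∃ C : ℝ, 0 ≤ C ∧ ∃ K : ℕ, ∀ s (σ t : ℝ), δ ≤ κ * ‖s‖ ^ 2 + σ →
      ‖laplaceIntegrand F s (σ + t * Complex.I)‖ ≤
        Real.exp σ * (C * (1 + ‖s‖) ^ K) * (1 + t ^ 2)⁻¹ := by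
  obtain ⟨C, hC, K, hb⟩ := hF.exists_bound h hδ
  refine ⟨C, hC, K, fun s σ t hs => ?_⟩
  have h1 := hb s (σ + t * Complex.I) (by simpa using hs)
  have h2 : (σ + t * Complex.I : ℂ).im = t := by simp
  have h3 : (σ + t * Complex.I : ℂ).re = σ := by simp
  rw [h2] at h1
  rw [laplaceIntegrand, norm_smul, Complex.norm_exp, h3, mul_assoc]
  refine mul_le_mul_of_nonneg_left (h1.trans ?_) (Real.exp_pos _).le
  gcongr
  nlinarith [sq_abs t, abs_nonneg t]

theorem continuous_line {k : ℕ} (h : IsBoundedBelow x κ) (hF : IsSymbol x κ k F)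
    {s : EuclideanSpace ℝ (Fin d)} {σ : ℝ} (hσ : 0 < κ * ‖s‖ ^ 2 + σ) :
    Continuous fun t : ℝ => laplaceIntegrand F s (σ + t * Complex.I) := by
  refine continuous_iff_continuousAt.mpr fun t => ?_
  have h1 : ContinuousAt (fun t : ℝ => (s, (σ + t * Complex.I : ℂ))) t := by fun_prop
  exact ContinuousAt.comp (f := fun t : ℝ => (s, (σ + t * Complex.I : ℂ)))
    (hF.continuousAt_laplaceIntegrand h (by simpa using hσ)) h1

theorem integrable_line (h : IsBoundedBelow x κ) (hF : IsSymbol x κ 2 F)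
    {s : EuclideanSpace ℝ (Fin d)} {σ : ℝ} (hσ : 0 < κ * ‖s‖ ^ 2 + σ) :
    Integrable fun t : ℝ => laplaceIntegrand F s (σ + t * Complex.I) := by
  obtain ⟨C, hC, K, hb⟩ := hF.exists_bound_laplaceIntegrand h hσ
  exact (integrable_inv_one_add_sq.const_mul _).mono'
    (hF.continuous_line h hσ).aestronglyMeasurable
    (Eventually.of_forall fun t => hb s σ t le_rfl)

theorem integral_line_eq (h : IsBoundedBelow x κ) (hF : IsSymbol x κ 2 F)
    {s : EuclideanSpace ℝ (Fin d)} {σ τ : ℝ} (hσ : 0 < κ * ‖s‖ ^ 2 + σ) (hστ : σ ≤ τ) :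
    ∫ t : ℝ, laplaceIntegrand F s (τ + t * Complex.I) =
      ∫ t : ℝ, laplaceIntegrand F s (σ + t * Complex.I) := by
  have hτ : 0 < κ * ‖s‖ ^ 2 + τ := by linarith
  obtain ⟨C, hC, K, hb⟩ := hF.exists_bound_laplaceIntegrand h hσ
  set M := Real.exp τ * (C * (1 + ‖s‖) ^ K) with hM
  have hb' : ∀ u ∈ Set.Icc σ τ, ∀ t : ℝ,
      ‖laplaceIntegrand F s (u + t * Complex.I)‖ ≤ M * (1 + t ^ 2)⁻¹ := by
    intro u hu t
    refine (hb s u t (by linarith [hu.1])).trans ?_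
    rw [hM]
    gcongr
    exact hu.2
  have hlim := intervalIntegral_tendsto_integral (hF.integrable_line h hσ)
    tendsto_neg_atTop_atBot tendsto_id
  have hlim' := intervalIntegral_tendsto_integral (hF.integrable_line h hτ)
    tendsto_neg_atTop_atBot tendsto_id
  have hzero : Tendsto (fun N : ℝ => M * (1 + N ^ 2)⁻¹ * |τ - σ|) atTop (𝓝 0) := by
    have h1 : Tendsto (fun N : ℝ => 1 + N ^ 2) atTop atTop :=
      tendsto_atTop_add_const_left _ _ (tendsto_pow_atTop two_ne_zero)
    simpa using (h1.inv_tendsto_atTop.const_mul M).mul_const |τ - σ|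
  have hhor : ∀ ε : ℝ, ε ^ 2 = 1 → Tendsto (fun N : ℝ =>
      ∫ u in σ..τ, laplaceIntegrand F s (u + ((ε * N : ℝ) : ℂ) * Complex.I)) atTop (𝓝 0) := by
    intro ε hε
    refine squeeze_zero_norm (fun N => ?_) hzero
    refine intervalIntegral.norm_integral_le_of_norm_le_const fun u hu => ?_
    rw [Set.uIoc_of_le hστ] at hu
    have := hb' u ⟨hu.1.le, hu.2⟩ (ε * N)
    rwa [mul_pow, hε, one_mul] at this
  have hrect : ∀ N : ℝ,
      (((∫ u in σ..τ, laplaceIntegrand F s (u + (((-1) * N : ℝ) : ℂ) * Complex.I)) -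
        ∫ u in σ..τ, laplaceIntegrand F s (u + ((1 * N : ℝ) : ℂ) * Complex.I)) +
        Complex.I • ∫ t in (-N)..N, laplaceIntegrand F s (τ + t * Complex.I)) -
        Complex.I • (∫ t in (-N)..N, laplaceIntegrand F s (σ + t * Complex.I)) = 0 := by
    intro N
    have h1 := Complex.integral_boundary_rect_eq_zero_of_differentiableOn
      (laplaceIntegrand F s) ⟨σ, -N⟩ ⟨τ, N⟩ (by
        intro z hz
        rw [Complex.mem_reProdIm, Set.uIcc_of_le hστ] at hz
        have hz1 : σ ≤ z.re := hz.1.1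
        have h2 := hF.differentiableAt h (s := s) (z := z) (by linarith)
        exact (Complex.differentiable_exp.differentiableAt.smul h2).differentiableWithinAt)
    simp only [Complex.ofReal_neg, neg_mul, one_mul] at h1 ⊢
    exact h1
  have htot := (((hhor (-1) (by norm_num)).sub (hhor 1 (by norm_num))).add
    (hlim'.const_smul Complex.I)).sub (hlim.const_smul Complex.I)
  have h0 := tendsto_nhds_unique htot (by
    simp only [id]
    refine tendsto_const_nhds.congr fun N => (hrect N).symm)
  rw [sub_zero, zero_add, ← smul_sub] at h0
  exact sub_eq_zero.mp ((smul_eq_zero.mp h0).resolve_left Complex.I_ne_zero)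

theorem laplaceInverse_eq (h : IsBoundedBelow x κ) (hF : IsSymbol x κ 2 F)
    {s : EuclideanSpace ℝ (Fin d)} {σ : ℝ} (hσ : 0 < κ * ‖s‖ ^ 2 + σ) :
    laplaceInverse F s =
      (2 * Real.pi : ℂ)⁻¹ • ∫ t : ℝ, laplaceIntegrand F s (σ + t * Complex.I) := by
  have h1 : 0 < κ * ‖s‖ ^ 2 + 1 := by
    have := h.pos
    positivity
  rw [laplaceInverse]
  congr 1
  rcases le_total σ 1 with hle | hle
  · exact hF.integral_line_eq h hσ hle
  · exact (hF.integral_line_eq h h1 hle).symm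

theorem pos_one (h : IsBoundedBelow x κ) (s : EuclideanSpace ℝ (Fin d)) :
    0 < κ * ‖s‖ ^ 2 + 1 := by
  have := h.pos
  positivity

theorem exists_bound_laplaceInverse (h : IsBoundedBelow x κ) (hF : IsSymbol x κ 2 F) :
    ∃ C : ℝ, 0 ≤ C ∧ ∃ K : ℕ, ∀ s, ‖laplaceInverse F s‖ ≤
      C * ((1 + ‖s‖) ^ K * Real.exp (-(κ * ‖s‖ ^ 2))) := by
  obtain ⟨C, hC, K, hb⟩ := hF.exists_bound_laplaceIntegrand h one_pos
  refine ⟨‖(2 * Real.pi : ℂ)⁻¹‖ * (Real.exp 1 * C * Real.pi), by positivity, K, fun s => ?_⟩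
  have h1 : κ * ‖s‖ ^ 2 + (1 - κ * ‖s‖ ^ 2) = 1 := by ring
  rw [hF.laplaceInverse_eq h (σ := 1 - κ * ‖s‖ ^ 2) (by rw [h1]; exact one_pos), norm_smul,
    mul_assoc]
  refine mul_le_mul_of_nonneg_left ?_ (norm_nonneg _)
  refine (norm_integral_le_of_norm_le (integrable_inv_one_add_sq.const_mul _)
    (Eventually.of_forall fun t => hb s _ t h1.ge)).trans (le_of_eq ?_)
  rw [integral_const_mul, integral_univ_inv_one_add_sq, sub_eq_add_neg, Real.exp_add]
  ring

theorem stronglyMeasurable_laplaceInverse (h : IsBoundedBelow x κ) (hF : IsSymbol x κ 2 F) :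
    StronglyMeasurable (laplaceInverse F) := by
  have h1 : Continuous fun p : EuclideanSpace ℝ (Fin d) × ℝ =>
      laplaceIntegrand F p.1 ((1 : ℝ) + p.2 * Complex.I) := by
    refine continuous_iff_continuousAt.mpr fun p => ?_
    have h2 : ContinuousAt (fun p : EuclideanSpace ℝ (Fin d) × ℝ =>
        (p.1, (((1 : ℝ) : ℂ) + p.2 * Complex.I : ℂ))) p := by fun_prop
    exact ContinuousAt.comp (f := fun p : EuclideanSpace ℝ (Fin d) × ℝ =>
        (p.1, (((1 : ℝ) : ℂ) + p.2 * Complex.I : ℂ)))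
      (hF.continuousAt_laplaceIntegrand h (by simpa using pos_one h p.1)) h2
  exact (h1.stronglyMeasurable.integral_prod_right' (ν := volume)).const_smul
    ((2 * Real.pi : ℂ)⁻¹)

end IsSymbol

theorem integrable_one_add_norm_pow_mul_exp {E : Type*} [NormedAddCommGroup E] [NormedSpace ℝ E]
    [FiniteDimensional ℝ E] [MeasurableSpace E] [BorelSpace E] (μ : Measure E)
    [μ.IsAddHaarMeasure] (K : ℕ) {κ : ℝ} (hκ : 0 < κ) :
    Integrable (fun s : E => (1 + ‖s‖) ^ K * Real.exp (-(κ * ‖s‖ ^ 2))) μ := by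
  set m := Module.finrank ℝ E + 1 with hm
  have h1 : Integrable (fun s : E => (1 + ‖s‖) ^ (-(m : ℝ))) μ :=
    integrable_one_add_norm (by rw [hm]; push_cast; linarith)
  have hc : Continuous fun s : E => (1 + ‖s‖) ^ K * Real.exp (-(κ * ‖s‖ ^ 2)) := by fun_prop
  refine (h1.const_mul ((K + m).factorial * Real.exp (1 + (4 * κ)⁻¹))).mono'
    hc.aestronglyMeasurable (Eventually.of_forall fun s => ?_)
  have hpos : 0 < 1 + ‖s‖ := by positivity
  rw [Real.norm_of_nonneg (by positivity), Real.rpow_neg hpos.le, Real.rpow_natCast,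
    ← div_eq_mul_inv, le_div_iff₀ (by positivity)]
  have h2 : (1 + ‖s‖) ^ (K + m) ≤ (K + m).factorial * Real.exp (1 + ‖s‖) := by
    have := Real.pow_div_factorial_le_exp (1 + ‖s‖) hpos.le (K + m)
    rwa [div_le_iff₀' (by positivity)] at this
  have h3 : Real.exp (1 + ‖s‖) * Real.exp (-(κ * ‖s‖ ^ 2)) ≤ Real.exp (1 + (4 * κ)⁻¹) := by
    rw [← Real.exp_add]
    refine Real.exp_le_exp.mpr ?_
    have h4 : ‖s‖ - κ * ‖s‖ ^ 2 = (4 * κ)⁻¹ - κ * (‖s‖ - (2 * κ)⁻¹) ^ 2 := by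
      field_simp
      ring
    have h5 : 0 ≤ κ * (‖s‖ - (2 * κ)⁻¹) ^ 2 := by positivity
    linarith
  calc (1 + ‖s‖) ^ K * Real.exp (-(κ * ‖s‖ ^ 2)) * (1 + ‖s‖) ^ m
      = (1 + ‖s‖) ^ (K + m) * Real.exp (-(κ * ‖s‖ ^ 2)) := by rw [pow_add]; ring
    _ ≤ ((K + m).factorial * Real.exp (1 + ‖s‖)) * Real.exp (-(κ * ‖s‖ ^ 2)) :=
        mul_le_mul_of_nonneg_right h2 (Real.exp_pos _).le
    _ = (K + m).factorial * (Real.exp (1 + ‖s‖) * Real.exp (-(κ * ‖s‖ ^ 2))) := by ring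
    _ ≤ _ := mul_le_mul_of_nonneg_left h3 (by positivity)

namespace IsSymbol

variable {x : Smooth θ} {κ : ℝ} {F G : EuclideanSpace ℝ (Fin d) → ℂ → Smooth θ}

theorem integrable_laplaceInverse (h : IsBoundedBelow x κ) (hF : IsSymbol x κ 2 F) :
    Integrable (laplaceInverse F) := by
  obtain ⟨C, _, K, hb⟩ := hF.exists_bound_laplaceInverse h
  exact ((integrable_one_add_norm_pow_mul_exp volume K h.pos).const_mul C).mono'
    (hF.stronglyMeasurable_laplaceInverse h).aestronglyMeasurable (Eventually.of_forall hb)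

theorem laplaceInverse_mem_Linfty (h : IsBoundedBelow x κ) (hF : IsSymbol x κ 2 F)
    (s : EuclideanSpace ℝ (Fin d)) : laplaceInverse F s ∈ Linfty θ :=
  smul_mem_Linfty _ (integral_mem_Linfty (hF.integrable_line h (pos_one h s))
    fun _ => smul_mem_Linfty _ (Smooth.mem_Linfty _))

theorem integral_laplaceInverse_const_mul (h : IsBoundedBelow x κ) (hF : IsSymbol x κ 2 F)
    (a : Smooth θ) :
    ∫ s, laplaceInverse (fun s z => a * F s z) s =
      (a : L2 d →L[ℂ] L2 d) * ∫ s, laplaceInverse F s := by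
  rw [← const_mul_integral (hF.integrable_laplaceInverse h)]
  refine integral_congr_ae (Eventually.of_forall fun s => ?_)
  simp only [laplaceInverse]
  rw [mul_smul_comm, ← const_mul_integral (hF.integrable_line h (pos_one h s))]
  simp only [laplaceIntegrand, mul_smul_comm, Subalgebra.coe_mul]

theorem integral_laplaceInverse_mul_const (h : IsBoundedBelow x κ) (hF : IsSymbol x κ 2 F)
    (a : Smooth θ) :
    ∫ s, laplaceInverse (fun s z => F s z * a) s =
      (∫ s, laplaceInverse F s) * (a : L2 d →L[ℂ] L2 d) := by
  rw [← integral_mul_const' (hF.integrable_laplaceInverse h)]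
  refine integral_congr_ae (Eventually.of_forall fun s => ?_)
  simp only [laplaceInverse]
  rw [smul_mul_assoc, ← integral_mul_const' (hF.integrable_line h (pos_one h s))]
  simp only [laplaceIntegrand, smul_mul_assoc, Subalgebra.coe_mul]

theorem integral_laplaceInverse_sub (h : IsBoundedBelow x κ) (hF : IsSymbol x κ 2 F)
    (hG : IsSymbol x κ 2 G) :
    ∫ s, laplaceInverse (fun s z => F s z - G s z) s =
      (∫ s, laplaceInverse F s) - ∫ s, laplaceInverse G s := by
  rw [← integral_sub (hF.integrable_laplaceInverse h) (hG.integrable_laplaceInverse h)]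
  refine integral_congr_ae (Eventually.of_forall fun s => ?_)
  simp only [laplaceInverse]
  rw [← smul_sub, ← integral_sub (hF.integrable_line h (pos_one h s))
    (hG.integrable_line h (pos_one h s))]
  simp only [laplaceIntegrand, ← smul_sub, Subalgebra.coe_sub]

theorem integral_laplaceInverse_sum (h : IsBoundedBelow x κ) {ι : Type*} (t : Finset ι)
    {F : ι → EuclideanSpace ℝ (Fin d) → ℂ → Smooth θ} (hF : ∀ i ∈ t, IsSymbol x κ 2 (F i)) :
    ∫ s, laplaceInverse (fun s z => ∑ i ∈ t, F i s z) s =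
      ∑ i ∈ t, ∫ s, laplaceInverse (F i) s := by
  rw [← integral_finsetSum t fun i hi => (hF i hi).integrable_laplaceInverse h]
  refine integral_congr_ae (Eventually.of_forall fun s => ?_)
  simp only [laplaceInverse]
  rw [← Finset.smul_sum,
    ← integral_finsetSum t fun i hi => (hF i hi).integrable_line h (pos_one h s)]
  simp only [laplaceIntegrand, ← Finset.smul_sum, AddSubmonoidClass.coe_finsetSum]

theorem laplaceInverse_congr (h : IsBoundedBelow x κ)
    (he : ∀ s z, 0 < κ * ‖s‖ ^ 2 + z.re → F s z = G s z) :
    laplaceInverse F = laplaceInverse G := by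
  funext s
  simp only [laplaceInverse, laplaceIntegrand]
  congr 2
  funext t
  rw [he s _ (by simpa using pos_one h s)]

/-- Integrals over `ℝ^d` of partial derivatives vanish. -/
theorem integral_laplaceInverse_eq_zero (h : IsBoundedBelow x κ) (hF : IsSymbol x κ 2 F)
    (hG : IsSymbol x κ 2 G) (v : EuclideanSpace ℝ (Fin d))
    (hFG : ∀ s z, 0 < κ * ‖s‖ ^ 2 + z.re →
      HasLineDerivAt ℝ (fun s => (F s z : L2 d →L[ℂ] L2 d)) (G s z) s v) :
    ∫ s, laplaceInverse G s = 0 := by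
  have hder : ∀ s, HasLineDerivAt ℝ (laplaceInverse F) (laplaceInverse G s) s v := by
    intro s
    obtain ⟨C, hC, K, hb⟩ := hG.exists_bound_laplaceIntegrand h one_pos
    have h1 : ∀ (s : EuclideanSpace ℝ (Fin d)), 1 ≤ κ * ‖s‖ ^ 2 + 1 := fun s => by
      have := h.pos
      have : 0 ≤ κ * ‖s‖ ^ 2 := by positivity
      linarith
    have hline : ∀ (z : ℂ) (t : ℝ), 0 < κ * ‖s + t • v‖ ^ 2 + z.re →
        HasDerivAt (fun t : ℝ => laplaceIntegrand F (s + t • v) z)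
          (laplaceIntegrand G (s + t • v) z) t := by
      intro z t hz
      have h2 : HasDerivAt (fun u : ℝ => (F (s + t • v + u • v) z : L2 d →L[ℂ] L2 d))
          (G (s + t • v) z) 0 := hFG (s + t • v) z hz
      have h3 : HasDerivAt (fun t : ℝ => (F (s + t • v) z : L2 d →L[ℂ] L2 d))
          (G (s + t • v) z) t := by
        have h4 := HasDerivAt.scomp_of_eq t h2 ((hasDerivAt_id t).sub_const t) (by simp)
        rw [one_smul] at h4
        refine h4.congr_of_eventuallyEq (Eventually.of_forall fun u => ?_)
        simp only [Function.comp, id]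
        rw [add_assoc, ← add_smul, add_sub_cancel]
      exact h3.const_smul (Complex.exp z)
    have hmain := hasDerivAt_integral_of_dominated_loc_of_deriv_le (μ := (volume : Measure ℝ))
      (F := fun (u : ℝ) (t : ℝ) => laplaceIntegrand F (s + u • v) ((1 : ℝ) + t * Complex.I))
      (F' := fun (u : ℝ) (t : ℝ) => laplaceIntegrand G (s + u • v) ((1 : ℝ) + t * Complex.I))
      (x₀ := (0 : ℝ))
      (bound := fun t => Real.exp 1 * (C * (1 + (‖s‖ + ‖v‖)) ^ K) * (1 + t ^ 2)⁻¹)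
      (Metric.ball_mem_nhds (0 : ℝ) one_pos)
      (Eventually.of_forall fun u =>
        (hF.continuous_line h (pos_one h (s + u • v))).aestronglyMeasurable)
      (hF.integrable_line h (pos_one h _))
      (hG.continuous_line h (pos_one h _)).aestronglyMeasurable
      (Eventually.of_forall fun t u hu => by
        refine (hb (s + u • v) 1 t (h1 _)).trans ?_
        have hu' : ‖u‖ ≤ 1 := by simpa using (Metric.mem_ball.mp hu).le
        have h5 : ‖s + u • v‖ ≤ ‖s‖ + ‖v‖ := by
          refine (norm_add_le _ _).trans (add_le_add le_rfl ?_)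
          rw [norm_smul]
          exact mul_le_of_le_one_left (norm_nonneg _) hu'
        gcongr)
      (integrable_inv_one_add_sq.const_mul _)
      (Eventually.of_forall fun t u _ => hline _ u (by simpa using pos_one h (s + u • v)))
    have h6 := hmain.2.const_smul ((2 * Real.pi : ℂ)⁻¹)
    simp only [zero_smul, add_zero] at h6
    exact h6
  have hi := hG.integrable_laplaceInverse h
  have hi' := hF.integrable_laplaceInverse h
  let B := (ContinuousLinearMap.lsmul ℝ ℝ (E := L2 d →L[ℂ] L2 d)).flip
  have h1 := integral_bilinear_hasLineDerivAt_right_eq_neg_left_of_integrable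
    (μ := (volume : Measure (EuclideanSpace ℝ (Fin d)))) (f := laplaceInverse F)
    (f' := laplaceInverse G) (g := fun _ => (1 : ℝ)) (g' := fun _ => 0) (v := v) (B := B)
    (by simpa [B] using hi) (by simp [B]) (by simpa [B] using hi')
    (fun s _ => hder s) (fun s _ => by
      simpa [HasLineDerivAt] using hasDerivAt_const (0 : ℝ) (1 : ℝ))
  simpa [B] using h1.symm

end IsSymbol

/-! ### Existence and uniqueness of the local invariants -/

theorem Coeffs.isCorr_laplaceInverse {c : Coeffs θ} {κ : ℝ} (h : IsBoundedBelow c.x κ) {k : ℕ}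
    (hk : 1 ≤ k) {s : EuclideanSpace ℝ (Fin d)} (hs : s ≠ 0) :
    c.IsCorr k s (laplaceInverse (c.corr k) s) := by
  have hF : IsSymbol c.x κ 2 (c.corr k) := IsSymbol.corr h hk
  have hpos : 0 < κ * ‖s‖ ^ 2 + 0 := by
    have := h.pos
    have := norm_pos_iff.mpr hs
    positivity
  intro ξ η
  have he : ∀ t : ℝ, Complex.exp (t * Complex.I) *
      inner ℂ ξ ((c.corr k s (t * Complex.I) : L2 d →L[ℂ] L2 d) η) =
      matrixCoeff ξ η (laplaceIntegrand (c.corr k) s ((0 : ℝ) + t * Complex.I)) := by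
    intro t
    rw [laplaceIntegrand, map_smul, matrixCoeff_apply, Complex.ofReal_zero, zero_add, smul_eq_mul]
  simp only [he]
  have hi := hF.integrable_line h hpos
  refine ⟨fun N => ((matrixCoeff ξ η).integrable_comp hi).intervalIntegrable, ?_⟩
  rw [← matrixCoeff_apply, hF.laplaceInverse_eq h hpos, map_smul,
    ← (matrixCoeff ξ η).integral_comp_comm hi, smul_eq_mul]
  exact (intervalIntegral_tendsto_integral ((matrixCoeff ξ η).integrable_comp hi)
    tendsto_neg_atTop_atBot tendsto_id).const_mul _

theorem Coeffs.isInvariant_integral {c : Coeffs θ} {κ : ℝ} (h : IsBoundedBelow c.x κ) {k : ℕ}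
    (hk : 1 ≤ k) : c.IsInvariant k (∫ s, laplaceInverse (c.corr k) s) := by
  have hF : IsSymbol c.x κ 2 (c.corr k) := IsSymbol.corr h hk
  have hi := hF.integrable_laplaceInverse h
  have hL : ∫ s, laplaceInverse (c.corr k) s ∈ Linfty θ :=
    integral_mem_Linfty hi (hF.laplaceInverse_mem_Linfty h)
  have h1 : ∀ ξ η : L2 d, Integrable fun s => matrixCoeff ξ η (laplaceInverse (c.corr k) s) :=
    fun ξ η => (matrixCoeff ξ η).integrable_comp hi
  have h2 : ∀ ξ η : L2 d, ∫ s, matrixCoeff ξ η (laplaceInverse (c.corr k) s) =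
      matrixCoeff ξ η (∫ s, laplaceInverse (c.corr k) s) :=
    fun ξ η => (matrixCoeff ξ η).integral_comp_comm hi
  simp only [matrixCoeff_apply] at h1 h2
  exact ⟨hL, laplaceInverse (c.corr k),
    fun s hs => ⟨hF.laplaceInverse_mem_Linfty h s, c.isCorr_laplaceInverse h hk hs⟩,
    fun ξ η => ⟨h1 ξ η, h2 ξ η⟩⟩

theorem Coeffs.IsCorr.unique {c : Coeffs θ} {k : ℕ} {s : EuclideanSpace ℝ (Fin d)}
    {C C' : L2 d →L[ℂ] L2 d} (h : c.IsCorr k s C) (h' : c.IsCorr k s C') : C = C' :=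
  ContinuousLinearMap.ext fun η => ext_inner_left ℂ fun ξ =>
    tendsto_nhds_unique (h ξ η).2 (h' ξ η).2

theorem Coeffs.IsInvariant.unique (hd : 0 < d) {c : Coeffs θ} {k : ℕ} {I I' : L2 d →L[ℂ] L2 d}
    (h : c.IsInvariant k I) (h' : c.IsInvariant k I') : I = I' := by
  obtain ⟨-, C, hC, hI⟩ := h
  obtain ⟨-, C', hC', hI'⟩ := h'
  have : Nonempty (Fin d) := ⟨⟨0, hd⟩⟩
  have hae : ∀ᵐ s : EuclideanSpace ℝ (Fin d), s ≠ 0 := by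
    rw [ae_iff]
    simp
  refine ContinuousLinearMap.ext fun η => ext_inner_left ℂ fun ξ => ?_
  rw [← (hI ξ η).2, ← (hI' ξ η).2]
  refine integral_congr_ae ?_
  filter_upwards [hae] with s hs
  rw [(hC s hs).2.unique (hC' s hs).2]

theorem IsLocalInvariant.unique (hd : 0 < d) {k : ℕ} {P : Smooth θ →ₗ[ℂ] Smooth θ}
    {I I' : L2 d →L[ℂ] L2 d} (h : IsLocalInvariant k P I) (h' : IsLocalInvariant k P I') :
    I = I' := by
  obtain ⟨c, -, -, hP, hc⟩ := h
  obtain ⟨c', -, -, hP', hc'⟩ := h'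
  obtain rfl : c = c' := Coeffs.op_injective hd (hP.symm.trans hP')
  exact hc.unique hd hc'

theorem IsLocalInvariant.isLocalInvariant_localInvariant {k : ℕ} {P : Smooth θ →ₗ[ℂ] Smooth θ}
    {I : L2 d →L[ℂ] L2 d} (h : IsLocalInvariant k P I) :
    IsLocalInvariant k P (localInvariant k P) := by
  have h' : ∃ I, IsLocalInvariant k P I := ⟨I, h⟩
  rw [localInvariant, dif_pos h']
  exact h'.choose_spec

/-! ### Partial derivatives with respect to `s` -/

/-- `F(·, z)` has the partial derivative `F'` in the direction `e_j` at `s`. -/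
def HasPartialAt (F : EuclideanSpace ℝ (Fin d) → ℂ → Smooth θ) (F' : Smooth θ)
    (s : EuclideanSpace ℝ (Fin d)) (z : ℂ) (j : Fin d) : Prop :=
  HasLineDerivAt ℝ (fun s => (F s z : L2 d →L[ℂ] L2 d)) (F' : L2 d →L[ℂ] L2 d) s
    (EuclideanSpace.single j (1 : ℝ))

namespace HasPartialAt

variable {F G : EuclideanSpace ℝ (Fin d) → ℂ → Smooth θ} {F' G' : Smooth θ}
  {s : EuclideanSpace ℝ (Fin d)} {z : ℂ} {j : Fin d}

theorem const (a : Smooth θ) : HasPartialAt (fun _ _ => a) 0 s z j :=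
  hasDerivAt_const (0 : ℝ) (a : L2 d →L[ℂ] L2 d)

theorem add (hF : HasPartialAt F F' s z j) (hG : HasPartialAt G G' s z j) :
    HasPartialAt (fun s z => F s z + G s z) (F' + G') s z j :=
  HasDerivAt.add (𝕜 := ℝ) hF hG

theorem mul (hF : HasPartialAt F F' s z j) (hG : HasPartialAt G G' s z j) :
    HasPartialAt (fun s z => F s z * G s z) (F' * G s z + F s z * G') s z j := by
  have h := HasDerivAt.mul (𝕜 := ℝ) hF hG
  simp only [zero_smul, add_zero] at h
  exact h

theorem smul {f : EuclideanSpace ℝ (Fin d) → ℂ} {f' : ℂ}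
    (hf : HasLineDerivAt ℝ f f' s (EuclideanSpace.single j (1 : ℝ)))
    (hF : HasPartialAt F F' s z j) :
    HasPartialAt (fun s z => f s • F s z) (f s • F' + f' • F s z) s z j := by
  have h := HasDerivAt.smul (𝕜 := ℝ) hf hF
  simp only [zero_smul, add_zero] at h
  exact h

theorem const_smul (c : ℂ) (hF : HasPartialAt F F' s z j) :
    HasPartialAt (fun s z => c • F s z) (c • F') s z j :=
  HasDerivAt.const_smul (𝕜 := ℝ) c hF

theorem sum {ι : Type*} (t : Finset ι) {F : ι → EuclideanSpace ℝ (Fin d) → ℂ → Smooth θ}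
    {F' : ι → Smooth θ} (hF : ∀ i ∈ t, HasPartialAt (F i) (F' i) s z j) :
    HasPartialAt (fun s z => ∑ i ∈ t, F i s z) (∑ i ∈ t, F' i) s z j := by
  have h := HasDerivAt.fun_sum (𝕜 := ℝ) hF
  rw [HasPartialAt, AddSubmonoidClass.coe_finsetSum]
  simp only [AddSubmonoidClass.coe_finsetSum]
  exact h

theorem congr_deriv (hF : HasPartialAt F F' s z j) (h : F' = G') : HasPartialAt F G' s z j :=
  h ▸ hF

theorem congr {κ : ℝ} (hF : HasPartialAt F F' s z j) (hz : 0 < κ * ‖s‖ ^ 2 + z.re)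
    (he : ∀ s z, 0 < κ * ‖s‖ ^ 2 + z.re → F s z = G s z) : HasPartialAt G F' s z j := by
  refine HasDerivAt.congr_of_eventuallyEq (𝕜 := ℝ) hF ?_
  have hc : Continuous fun t : ℝ => (s + t • EuclideanSpace.single j (1 : ℝ), z) := by fun_prop
  filter_upwards [((IsSymbol.isOpen_domain κ).preimage hc).mem_nhds
    (show (0 : ℝ) ∈ _ by simpa using hz)] with t ht
  rw [he _ _ ht]

end HasPartialAt

theorem hasLineDerivAt_coord (s : EuclideanSpace ℝ (Fin d)) (i j : Fin d) :
    HasLineDerivAt ℝ (fun s : EuclideanSpace ℝ (Fin d) => (s i : ℂ)) (if i = j then 1 else 0) s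
      (EuclideanSpace.single j (1 : ℝ)) := by
  have h1 : HasDerivAt (fun t : ℝ => (s i : ℂ) + t * (if i = j then 1 else 0))
      (1 * (if i = j then 1 else 0)) 0 :=
    ((Complex.ofRealCLM.hasDerivAt (x := (0 : ℝ))).mul_const _).const_add _
  rw [one_mul] at h1
  refine h1.congr_of_eventuallyEq (Eventually.of_forall fun t => ?_)
  by_cases hij : i = j
  · subst hij
    simp
  · simp [hij]

theorem hasLineDerivAt_norm_sq (s : EuclideanSpace ℝ (Fin d)) (j : Fin d) :
    HasLineDerivAt ℝ (fun s : EuclideanSpace ℝ (Fin d) => ((‖s‖ ^ 2 : ℝ) : ℂ)) (2 * s j) s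
      (EuclideanSpace.single j (1 : ℝ)) := by
  have h1 := ((hasStrictFDerivAt_norm_sq s).hasFDerivAt).hasLineDerivAt
    (EuclideanSpace.single j (1 : ℝ))
  have h2 := Complex.ofRealCLM.hasFDerivAt.comp_hasDerivAt (0 : ℝ) h1
  have e : Complex.ofRealCLM (((2 : ℕ) • innerSL ℝ s) (EuclideanSpace.single j (1 : ℝ))) =
      2 * (s j : ℂ) := by
    simp [EuclideanSpace.inner_single_right]
  rw [← e]
  exact h2

theorem IsBoundedBelow.hasPartialAt_resolvent {x : Smooth θ} {κ : ℝ} (h : IsBoundedBelow x κ)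
    {s : EuclideanSpace ℝ (Fin d)} {z : ℂ} (hz : 0 < κ * ‖s‖ ^ 2 + z.re) (j : Fin d) :
    HasPartialAt (resolvent x)
      (-((2 * s j : ℂ) • (resolvent x s z * (x * resolvent x s z)))) s z j := by
  have h1 : HasPartialAt (pencil x) ((2 * s j : ℂ) • x) s z j := by
    have h2 := (HasPartialAt.smul (z := z) (hasLineDerivAt_norm_sq s j)
      (HasPartialAt.const x)).add (HasPartialAt.const (z • 1))
    rw [smul_zero, zero_add, add_zero] at h2
    exact h2
  have h2 := h.hasDerivAt_resolvent (𝕜 := ℝ)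
    (s := fun t : ℝ => s + t • EuclideanSpace.single j (1 : ℝ)) (z := fun _ => z) (t := 0)
    (by simpa using hz) h1
  simp only [zero_smul, add_zero] at h2
  have e : (-((2 * s j : ℂ) • (resolvent x s z * (x * resolvent x s z))) : Smooth θ) =
      -(resolvent x s z * ((2 * s j : ℂ) • x) * resolvent x s z) := by
    rw [mul_smul_comm, smul_mul_assoc, mul_assoc]
  rw [e]
  exact h2

theorem partial_D_resolvent_identity {A : Type*} [Ring A] [Algebra ℂ A] (r x x' : A) (ρ c : ℂ) :
    (-1 : ℂ) • (ρ • ((-(c • (r * (x * r))) * x' + r * 0) * r +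
      r * x' * -(c • (r * (x * r)))) + c • (r * x' * r)) =
    -(c • (-(ρ • (r * x' * r)) * (x * r) + r * (x' * r + x * -(ρ • (r * x' * r))))) := by
  simp only [mul_add, mul_zero, smul_mul_assoc, mul_smul_comm, neg_mul, mul_neg,
    mul_assoc, smul_add, smul_neg, smul_smul, add_zero]
  module

theorem IsBoundedBelow.hasPartialAt_D_resolvent {x : Smooth θ} {κ : ℝ} (h : IsBoundedBelow x κ)
    {s : EuclideanSpace ℝ (Fin d)} {z : ℂ} (hz : 0 < κ * ‖s‖ ^ 2 + z.re) (i j : Fin d) :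
    HasPartialAt (fun s z => D θ i (resolvent x s z))
      (-((2 * s j : ℂ) • D θ i (resolvent x s z * (x * resolvent x s z)))) s z j := by
  have hr := h.hasPartialAt_resolvent hz j
  have h1 := (((hr.mul (HasPartialAt.const (D θ i x))).mul hr).smul
    (hasLineDerivAt_norm_sq s j)).const_smul (-1)
  refine (h1.congr hz fun s z hz => ?_).congr_deriv ?_
  · rw [h.D_resolvent hz, neg_smul, one_smul]
  · rw [D_mul, D_mul, h.D_resolvent hz]
    exact partial_D_resolvent_identity _ _ _ _ _

/-! ### The second correction term as a divergence -/

section Derivations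

variable {A : Type*} [Ring A] [Algebra ℂ A] (δ : Fin d → A →ₗ[ℂ] A)

theorem second_order_expand (hδ : ∀ i a b, δ i (a * b) = δ i a * b + a * δ i b) (r x y : A)
    (i j : Fin d) :
    r * (x * δ j (r * (x * δ i (r * y)))) =
      r * (x * δ j (r * (x * δ i r))) * y + r * (x * r) * (x * δ i r) * δ j y +
        r * (x * δ j (r * (x * r))) * δ i y + r * (x * r) * (x * r) * δ j (δ i y) := by
  simp only [hδ, map_add, mul_add, add_mul, mul_assoc]
  abel

/-- The derivative with respect to `s_j` of the `i`-th summand of the vector field, without the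
contribution of the factor `s_i`. -/
def fieldDerivTerm (r x y : A) (i j : Fin d) : A :=
  (2 : ℂ) • ((r * (x * r) * (x * δ i r) + r * (x * δ i (r * (x * r)))) * δ j y) +
    (2 : ℂ) • (r * (x * r) * (x * r) * δ i (δ j y))

/-- The `i`-th summand of the vector field, without the factor `s_i`. -/
def fieldTerm (r x y : A) (i j : Fin d) : A :=
  (2 : ℂ) • (r * (x * δ i r) * δ j y) + r * (x * r) * δ i (δ j y)

theorem second_correction_identity (hδ : ∀ i a b, δ i (a * b) = δ i a * b + a * δ i b)
    (hcomm : ∀ i j a, δ i (δ j a) = δ j (δ i a)) (r x y : A) (s : Fin d → ℂ) :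
    r * ∑ j, s j • (2 : ℂ) • (x * δ j (r * ∑ i, s i • (2 : ℂ) • (x * δ i (r * y)))) -
        r * (x * ∑ j, δ j (δ j (r * y))) =
      (r * ∑ j, s j • (2 : ℂ) • (x * δ j (r * ∑ i, s i • (2 : ℂ) • (x * δ i r))) -
        r * (x * ∑ j, δ j (δ j r))) * y -
      ∑ j, ∑ i, (s i • -((2 * s j) • fieldDerivTerm δ r x y i j) +
        (if i = j then (1 : ℂ) else 0) • fieldTerm δ r x y i j) := by
  have h1 : ∀ w : A,
      r * ∑ j, s j • (2 : ℂ) • (x * δ j (r * ∑ i, s i • (2 : ℂ) • (x * δ i w))) =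
        ∑ j, ∑ i, (4 * (s j * s i)) • (r * (x * δ j (r * (x * δ i w)))) := by
    intro w
    simp only [Finset.mul_sum, map_sum, map_smul, mul_smul_comm, Finset.smul_sum, smul_smul]
    refine Finset.sum_congr rfl fun j _ => Finset.sum_congr rfl fun i _ => ?_
    congr 1
    ring
  have h2 : ∀ j, r * (x * δ j (δ j (r * y))) =
      r * (x * δ j (δ j r)) * y + fieldTerm δ r x y j j := by
    intro j
    rw [fieldTerm, two_smul]
    simp only [hδ, map_add, mul_add, mul_assoc]
    abel
  have h3 : ∑ j, ∑ i, (4 * (s j * s i)) • (r * (x * δ j (r * (x * r))) * δ i y) =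
      ∑ j, ∑ i, (4 * (s j * s i)) • (r * (x * δ i (r * (x * r))) * δ j y) := by
    rw [Finset.sum_comm]
    refine Finset.sum_congr rfl fun j _ => Finset.sum_congr rfl fun i _ => ?_
    rw [mul_comm (s i)]
  have h4 : ∑ j, ∑ i, (if i = j then (1 : ℂ) else 0) • fieldTerm δ r x y i j =
      ∑ j, fieldTerm δ r x y j j := by
    refine Finset.sum_congr rfl fun j _ => ?_
    rw [Finset.sum_eq_single j]
    · rw [if_pos rfl, one_smul]
    · intro i _ hi
      rw [if_neg hi, zero_smul]
    · simp
  have h5 : ∀ j i, s i • -((2 * s j) • fieldDerivTerm δ r x y i j) =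
      -((4 * (s j * s i)) • (r * (x * r) * (x * δ i r) * δ j y) +
        (4 * (s j * s i)) • (r * (x * δ i (r * (x * r))) * δ j y) +
        (4 * (s j * s i)) • (r * (x * r) * (x * r) * δ j (δ i y))) := by
    intro j i
    rw [fieldDerivTerm, hcomm j i, add_mul]
    module
  have h6 : r * (x * ∑ j, δ j (δ j (r * y))) =
      r * (x * ∑ j, δ j (δ j r)) * y + ∑ j, fieldTerm δ r x y j j := by
    simp only [Finset.mul_sum, Finset.sum_mul, h2, Finset.sum_add_distrib]
  rw [h1, h1, h6]
  simp only [second_order_expand δ hδ, smul_add, Finset.sum_add_distrib, h3, h4, h5,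
    Finset.sum_neg_distrib, sub_mul, Finset.sum_mul, smul_mul_assoc]
  abel

end Derivations

/-- The vector field whose divergence is the deviation of the second correction term from being
conjugation invariant. -/
def field (x y : Smooth θ) (j : Fin d) (s : EuclideanSpace ℝ (Fin d)) (z : ℂ) : Smooth θ :=
  ∑ i, (s i : ℂ) • fieldTerm (D θ) (resolvent x s z) x y i j

/-- The derivative of `field x y j` with respect to `s_j`. -/
def fieldDeriv (x y : Smooth θ) (j : Fin d) (s : EuclideanSpace ℝ (Fin d)) (z : ℂ) : Smooth θ :=
  ∑ i, ((s i : ℂ) • -((2 * s j : ℂ) • fieldDerivTerm (D θ) (resolvent x s z) x y i j) +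
    (if i = j then (1 : ℂ) else 0) • fieldTerm (D θ) (resolvent x s z) x y i j)

theorem fieldTerm_deriv_identity {A : Type*} [Ring A] [Algebra ℂ A] (r x r₁ l₁ y₁ y₂ : A) (c : ℂ) :
    (2 : ℂ) • ((-(c • (r * (x * r))) * (x * r₁) + r * (0 * r₁ + x * -(c • l₁))) * y₁ +
        r * (x * r₁) * 0) +
      ((-(c • (r * (x * r))) * (x * r) + r * (0 * r + x * -(c • (r * (x * r))))) * y₂ +
        r * (x * r) * 0) =
    -(c • ((2 : ℂ) • ((r * (x * r) * (x * r₁) + r * (x * l₁)) * y₁) +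
      (2 : ℂ) • (r * (x * r) * (x * r) * y₂))) := by
  simp only [add_mul, mul_zero, zero_mul, smul_mul_assoc, mul_smul_comm, neg_mul, mul_neg,
    mul_assoc, zero_add, add_zero]
  module

theorem IsBoundedBelow.hasPartialAt_field {x : Smooth θ} {κ : ℝ} (h : IsBoundedBelow x κ)
    (y : Smooth θ) {s : EuclideanSpace ℝ (Fin d)} {z : ℂ} (hz : 0 < κ * ‖s‖ ^ 2 + z.re)
    (j : Fin d) : HasPartialAt (field x y j) (fieldDeriv x y j s z) s z j := by
  have hr := h.hasPartialAt_resolvent hz j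
  have hx := HasPartialAt.const (s := s) (z := z) (j := j) x
  refine HasPartialAt.sum Finset.univ fun i _ =>
    HasPartialAt.smul (hasLineDerivAt_coord s i j) ?_
  have h1 := ((hr.mul (hx.mul (h.hasPartialAt_D_resolvent hz i j))).mul
    (HasPartialAt.const (D θ j y))).const_smul 2
  have h2 := (hr.mul (hx.mul hr)).mul (HasPartialAt.const (D θ i (D θ j y)))
  exact (h1.add h2).congr_deriv (fieldTerm_deriv_identity _ _ _ _ _ _ _)

namespace IsSymbol

variable {x : Smooth θ} {κ : ℝ}

protected theorem fieldTerm (h : IsBoundedBelow x κ) (y : Smooth θ) (i j : Fin d) :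
    IsSymbol x κ 2 fun s z => fieldTerm (D θ) (resolvent x s z) x y i j := by
  have hr : IsSymbol x κ 1 fun s z => resolvent x s z := IsSymbol.res
  exact (((hr.mul ((hr.D h i).const_mul x)).mul_const (D θ j y)).smul 2).add
    ((hr.mul (hr.const_mul x)).mul_const (D θ i (D θ j y)))

protected theorem fieldDerivTerm (h : IsBoundedBelow x κ) (y : Smooth θ) (i j : Fin d) :
    IsSymbol x κ 2 fun s z => fieldDerivTerm (D θ) (resolvent x s z) x y i j := by
  have hr : IsSymbol x κ 1 fun s z => resolvent x s z := IsSymbol.res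
  have hl : IsSymbol x κ 2 fun s z => resolvent x s z * (x * resolvent x s z) :=
    hr.mul (hr.const_mul x)
  have h1 : IsSymbol x κ 3 fun s z => resolvent x s z * (x * resolvent x s z) *
      (x * D θ i (resolvent x s z)) := hl.mul ((hr.D h i).const_mul x)
  have h2 : IsSymbol x κ 3 fun s z => resolvent x s z *
      (x * D θ i (resolvent x s z * (x * resolvent x s z))) := hr.mul ((hl.D h i).const_mul x)
  have h3 : IsSymbol x κ 3 fun s z => resolvent x s z * (x * resolvent x s z) *
      (x * resolvent x s z) := hl.mul (hr.const_mul x)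
  exact ((((h1.add h2).mul_const (D θ j y)).smul 2).add
    ((h3.mul_const (D θ i (D θ j y))).smul 2)).mono

protected theorem field (h : IsBoundedBelow x κ) (y : Smooth θ) (j : Fin d) :
    IsSymbol x κ 2 (field x y j) :=
  IsSymbol.sum Finset.univ fun i _ => (IsSymbol.fieldTerm h y i j).coord_smul i

protected theorem fieldDeriv (h : IsBoundedBelow x κ) (y : Smooth θ) (j : Fin d) :
    IsSymbol x κ 2 (fieldDeriv x y j) := by
  refine IsSymbol.sum Finset.univ fun i _ => IsSymbol.add ?_
    ((IsSymbol.fieldTerm h y i j).smul _)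
  refine ((((IsSymbol.fieldDerivTerm h y i j).smul 2).coord_smul j).neg.coord_smul i).congr
    fun s z _ => ?_
  rw [smul_smul, mul_comm (s j : ℂ)]

end IsSymbol

theorem integral_laplaceInverse_fieldDeriv {x : Smooth θ} {κ : ℝ} (h : IsBoundedBelow x κ)
    (y : Smooth θ) (j : Fin d) : ∫ s, laplaceInverse (fieldDeriv x y j) s = 0 :=
  IsSymbol.integral_laplaceInverse_eq_zero h (IsSymbol.field h y j) (IsSymbol.fieldDeriv h y j)
    (EuclideanSpace.single j (1 : ℝ)) fun _ _ hz => h.hasPartialAt_field y hz j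

/-! ### The two operators -/

/-- The coefficients of `λ_l(x) Δ`. -/
def lapCoeffs (x : Smooth θ) : Coeffs θ := ⟨x, 0, 0⟩

/-- The coefficients of `λ_l(y⁻¹ x) Δ λ_l(y)`. -/
def conjLapCoeffs (x : Smooth θ) (y : (Smooth θ)ˣ) : Coeffs θ where
  x := x
  a₁ i := (2 : ℂ) • (↑y⁻¹ * x * D θ i y)
  a₀ := ↑y⁻¹ * x * Lap θ y

theorem lapCoeffs_op (x : Smooth θ) : (lapCoeffs x).op = lmul x ∘ₗ Lap θ := by
  ext1 u
  rw [Coeffs.op_apply]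
  simp [lapCoeffs, lmul]

theorem lapCoeffs_V (x : Smooth θ) (s : EuclideanSpace ℝ (Fin d)) (u : Smooth θ) :
    (lapCoeffs x).V s u = ∑ i, (s i : ℂ) • (2 : ℂ) • (x * D θ i u) := by
  rw [Coeffs.V_apply]
  simp [lapCoeffs]

theorem Lap_mul (a b : Smooth θ) :
    Lap θ (a * b) = Lap θ a * b + ∑ i, (2 : ℂ) • (D θ i a * D θ i b) + a * Lap θ b := by
  simp only [Lap_apply, Finset.sum_mul, Finset.mul_sum]
  rw [← Finset.sum_add_distrib, ← Finset.sum_add_distrib]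
  refine Finset.sum_congr rfl fun i _ => ?_
  rw [D_mul, map_add, D_mul, D_mul, two_smul]
  abel

theorem inv_mul_mul_eq {x : Smooth θ} {y : (Smooth θ)ˣ} (hxy : x * y = y * x) : (↑y⁻¹ * x : Smooth θ) * y = x := by
  rw [mul_assoc, hxy, Units.inv_mul_cancel_left]

theorem conjLapCoeffs_V {x : Smooth θ} {y : (Smooth θ)ˣ} (hxy : x * y = y * x)
    (s : EuclideanSpace ℝ (Fin d)) (u : Smooth θ) :
    (conjLapCoeffs x y).V s u = ↑y⁻¹ * (lapCoeffs x).V s (y * u) := by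
  rw [Coeffs.V_apply, lapCoeffs_V, Finset.mul_sum]
  refine Finset.sum_congr rfl fun i _ => ?_
  rw [mul_smul_comm, mul_smul_comm, D_mul, ← mul_assoc, mul_add, ← mul_assoc _ (y : Smooth θ),
    inv_mul_mul_eq hxy, smul_add (2 : ℂ), add_comm ((2 : ℂ) • _ : Smooth θ)]
  simp only [conjLapCoeffs]
  rw [smul_mul_assoc, mul_assoc (↑y⁻¹ * x)]

theorem conjLapCoeffs_op_apply {x : Smooth θ} {y : (Smooth θ)ˣ} (hxy : x * y = y * x)
    (u : Smooth θ) :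
    (conjLapCoeffs x y).op u = ↑y⁻¹ * (lapCoeffs x).op (y * u) := by
  rw [Coeffs.op_apply, lapCoeffs_op]
  change _ = ↑y⁻¹ * (x * Lap θ (y * u))
  rw [Lap_mul, ← mul_assoc, mul_add, mul_add, ← mul_assoc _ (y : Smooth θ), inv_mul_mul_eq hxy,
    Finset.mul_sum]
  simp only [conjLapCoeffs, smul_mul_assoc, mul_smul_comm, mul_assoc]
  abel

theorem Coeffs.corr_two (c : Coeffs θ) (s : EuclideanSpace ℝ (Fin d)) (z : ℂ) :
    c.corr 2 s z = c.res s z * (c.V s (c.res s z * c.V s (c.res s z)) - c.op (c.res s z)) := by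
  have h1 : (Finset.range (2 + 1)).filter (fun m => 2 ≤ 2 * m) = {1, 2} := by decide
  have h2 : (Finset.Icc 1 1).powersetCard (2 * 1 - 2) = {∅} := by decide
  have h3 : (Finset.Icc 1 2).powersetCard (2 * 2 - 2) = {{1, 2}} := by decide
  rw [Coeffs.corr, h1, Finset.sum_pair (by norm_num), h2, h3, Finset.sum_singleton,
    Finset.sum_singleton]
  simp only [Coeffs.f, Finset.notMem_empty, if_false, mul_one, pow_one, neg_smul, one_smul,
    Nat.reduceAdd, Finset.mem_insert, Finset.mem_singleton, true_or, or_true, if_true,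
    neg_one_sq, zero_add]
  rw [neg_add_eq_sub]

theorem res_lapCoeffs (x : Smooth θ) (s : EuclideanSpace ℝ (Fin d)) (z : ℂ) :
    (lapCoeffs x).res s z = resolvent x s z := rfl

theorem res_conjLapCoeffs (x : Smooth θ) (y : (Smooth θ)ˣ) (s : EuclideanSpace ℝ (Fin d))
    (z : ℂ) : (conjLapCoeffs x y).res s z = resolvent x s z := rfl

theorem IsBoundedBelow.commute_resolvent {x : Smooth θ} {κ : ℝ} (h : IsBoundedBelow x κ)
    {y : Smooth θ} (hxy : x * y = y * x) {s : EuclideanSpace ℝ (Fin d)} {z : ℂ}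
    (hz : 0 < κ * ‖s‖ ^ 2 + z.re) : Commute (resolvent x s z) y := by
  have h1 : Commute (pencil x s z) y := by
    change (_ + _) * y = y * (_ + _)
    rw [add_mul, mul_add, smul_mul_assoc, smul_mul_assoc, mul_smul_comm, mul_smul_comm, hxy,
      one_mul, mul_one]
  obtain ⟨u, hu⟩ := h.isUnit_pencil hz
  rw [resolvent, ← hu, Ring.inverse_unit]
  rw [← hu] at h1
  exact h1.units_inv_left

theorem IsBoundedBelow.corr_conjLapCoeffs {x : Smooth θ} {κ : ℝ} (h : IsBoundedBelow x κ)
    {y : (Smooth θ)ˣ} (hxy : x * y = y * x) {s : EuclideanSpace ℝ (Fin d)} {z : ℂ}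
    (hz : 0 < κ * ‖s‖ ^ 2 + z.re) :
    (conjLapCoeffs x y).corr 2 s z =
      ↑y⁻¹ * ((lapCoeffs x).corr 2 s z * y - ∑ j, fieldDeriv x (y : Smooth θ) j s z) := by
  have hry := h.commute_resolvent hxy hz
  have hry' : Commute (resolvent x s z) (↑y⁻¹ : Smooth θ) := hry.units_inv_right
  rw [Coeffs.corr_two, Coeffs.corr_two, res_lapCoeffs, res_conjLapCoeffs]
  set r := resolvent x s z with hr
  simp only [conjLapCoeffs_V hxy, conjLapCoeffs_op_apply hxy]
  rw [← mul_assoc r (↑y⁻¹ : Smooth θ), hry'.eq, mul_assoc _ r, Units.mul_inv_cancel_left,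
    ← mul_sub, ← mul_assoc r, hry'.eq, mul_assoc, ← hry.eq]
  congr 1
  have key := second_correction_identity (D θ) D_mul D_comm r x (y : Smooth θ)
    fun i => (s i : ℂ)
  rw [mul_sub, mul_sub]
  simp only [lapCoeffs_V, lapCoeffs_op]
  change _ - r * (x * Lap θ (r * y)) = (_ - r * (x * Lap θ r)) * _ - _
  rw [Lap_apply, Lap_apply]
  exact key

theorem integral_laplaceInverse_corr_conjLapCoeffs {x : Smooth θ} {κ : ℝ}
    (h : IsBoundedBelow x κ) {y : (Smooth θ)ˣ} (hxy : x * y = y * x) :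
    ∫ s, laplaceInverse ((conjLapCoeffs x y).corr 2) s =
      ((↑y⁻¹ : Smooth θ) : L2 d →L[ℂ] L2 d) * (∫ s, laplaceInverse ((lapCoeffs x).corr 2) s) *
        ((y : Smooth θ) : L2 d →L[ℂ] L2 d) := by
  have hF : IsSymbol x κ 2 fun s z => (lapCoeffs x).corr 2 s z :=
    IsSymbol.corr (c := lapCoeffs x) h one_le_two
  have hG := IsSymbol.sum Finset.univ fun j (_ : j ∈ Finset.univ) =>
    IsSymbol.fieldDeriv h (y : Smooth θ) j
  have hFy := hF.mul_const (y : Smooth θ)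
  rw [IsSymbol.laplaceInverse_congr h (fun s z hz => h.corr_conjLapCoeffs hxy hz),
    (hFy.sub hG).integral_laplaceInverse_const_mul h, IsSymbol.integral_laplaceInverse_sub h hFy hG,
    hF.integral_laplaceInverse_mul_const h, IsSymbol.integral_laplaceInverse_sum h Finset.univ
      (fun j _ => IsSymbol.fieldDeriv h (y : Smooth θ) j),
    Finset.sum_eq_zero fun j _ => integral_laplaceInverse_fieldDeriv h (y : Smooth θ) j,
    sub_zero, mul_assoc]

end NCTorus

end

theorem proposition8p5 {d : ℕ} (hd : 2 ≤ d) (θ : Matrix (Fin d) (Fin d) ℝ) (hθ : θ.transpose = -θ)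
    (x : NCTorus.Smooth θ) (hx : IsUnit x)
    (hpos : (x : NCTorus.L2 d →L[ℂ] NCTorus.L2 d).IsPositive)
    (y : (NCTorus.Smooth θ)ˣ) (hxy : x * (y : NCTorus.Smooth θ) = (y : NCTorus.Smooth θ) * x) :
    let P : NCTorus.Smooth θ →ₗ[ℂ] NCTorus.Smooth θ := NCTorus.lmul x ∘ₗ NCTorus.Lap θ
    let Q : NCTorus.Smooth θ →ₗ[ℂ] NCTorus.Smooth θ :=
      NCTorus.lmul ((↑y⁻¹ : NCTorus.Smooth θ) * x) ∘ₗ NCTorus.Lap θ ∘ₗ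
        NCTorus.lmul (y : NCTorus.Smooth θ)
    NCTorus.IsLocalInvariant 2 P (NCTorus.localInvariant 2 P) ∧
    NCTorus.IsLocalInvariant 2 Q (NCTorus.localInvariant 2 Q) ∧
    NCTorus.localInvariant 2 Q =
      ((↑y⁻¹ : NCTorus.Smooth θ) : NCTorus.L2 d →L[ℂ] NCTorus.L2 d) *
        NCTorus.localInvariant 2 P *
        ((y : NCTorus.Smooth θ) : NCTorus.L2 d →L[ℂ] NCTorus.L2 d) := by
  intro P Q
  obtain ⟨κ, h⟩ := NCTorus.exists_isBoundedBelow hpos hx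
  have hP : NCTorus.IsLocalInvariant 2 P _ :=
    ⟨NCTorus.lapCoeffs x, hpos, hx, (NCTorus.lapCoeffs_op x).symm,
      NCTorus.Coeffs.isInvariant_integral (c := NCTorus.lapCoeffs x) h one_le_two⟩
  have hQ : NCTorus.IsLocalInvariant 2 Q _ :=
    ⟨NCTorus.conjLapCoeffs x y, hpos, hx, LinearMap.ext fun u => by
      rw [NCTorus.conjLapCoeffs_op_apply hxy, NCTorus.lapCoeffs_op]
      exact mul_assoc (↑y⁻¹ : NCTorus.Smooth θ) x _,
      NCTorus.Coeffs.isInvariant_integral (c := NCTorus.conjLapCoeffs x y) h one_le_two⟩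
  have hP' := hP.isLocalInvariant_localInvariant
  have hQ' := hQ.isLocalInvariant_localInvariant
  refine ⟨hP', hQ', ?_⟩
  have hd' : 0 < d := by omega
  rw [hP'.unique hd' hP, hQ'.unique hd' hQ]
  exact NCTorus.integral_laplaceInverse_corr_conjLapCoeffs h hxy
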